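/- **Setting.** An algorithm is run on a sequential machine with a real-word memory. Its arithmetic cost is the number of arithmetic operations and comparisons ($+,-,\times,/,|\cdot|,<$). Its serial communication cost, for a fast memory of $M$ words, is the smallest number of words that have to be moved between slow and fast memory (in either direction) when the operands of every operation have to be in fast memory while the operation is carried out. Let $2<\omega_0\le 3$ and $0<f<1$. Matrices are multiplied in $O(n^{\omega_0})$ operations by a Strassen-like algorithm: a fixed bilinear algorithm multiplying $d\times d$ matrices ($d\ge 2$) with $r\le d^{\omega_0}$ multiplications is applied recursively to blocks (padded by zeros). *Recursive Jacobi* with log block size $f$ and threshold $n_{\rm threshold}$ takes a symmetric $A\in\mathbb R^{n\times n}$ and puts $Q=I$, $b=\lfloor n^f\rfloor$. If $n<n_{\rm threshold}$ or $2b\ge n$, it diagonalizes $A=QDQ^T$ directly, a single operation with its operands $A$, $Q$ in fast memory and an arbitrary arithmetic cost depending only on $n$. Otherwise $A$ is partitioned into $b\times b$ blocks (the last block row and column are smaller if $b\nmid n$), and one sweep does the following once for every pair $I<J$ of block indices, in some order: let $\hat A$ be the (at most $2b\times 2b$) submatrix of $A$ in block rows and columns $I$ and $J$; if its off-diagonal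 part (the largest absolute value or the sum of squares of the off-diagonal entries) exceeds a tolerance, then compute $\hat Q$ by one sweep of recursive Jacobi, with the same $f$ and $n_{\rm threshold}$, on $\hat A$; optionally replace $\hat Q$ by $\hat QP^T$, where $P$ is the permutation matrix of the recursive LU factorization with partial pivoting of $\hat Q(1\!:\!b,:)^T$; then multiply block rows $I,J$ of $A$ by $\hat Q^T$, and block columns $I,J$ of $A$ and of $Q$ by $\hat Q$. At the end of the sweep the off-diagonal part of $A$ is compared with a tolerance. All matrix products, including those inside the LU factorization, use the multiplication algorithm above, block rows and columns being multiplied in pieces of the size of $\hat Q$. **Theorem.** Let $F(n)$ and $W(n)$ be the arithmetic and serial communication costs of one sweep of recursive Jacobi, in the worst case over symmetric $n\times n$ inputs, orders, tolerances, and choices of the optional steps. Suppose that $n_{\rm threshold}$ and the fast memory size $M$ are integers with $$(1-f)^{-1}<\log_2(n_{\rm threshold})\quad\text{and}\quad n_{\rm threshold}\le\sqrt{M/2}.$$ Then $$F(n)=O\!\left(n^{3(1-f)+\omega_0 f}\right),\qquad W(n)=O\!\left(\frac{n^{3(1-f)+\omega_0 f}}{M^{\omega_0/2-1}}\right)\qquad(n\to\infty),$$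 where the implied constants depend only on $\omega_0$, $f$ and the bilinear algorithm, and the bounds hold for all $n$ sufficiently large, depending also on $n_{\rm threshold}$, $M$ and the cost of the direct diagonalizations. -/

import Mathlib

/-!
One sweep of recursive Jacobi, written as a program for a sequential machine with a counted
arithmetic cost and a memory trace whose two-level communication cost is measured.
-/

namespace RecJacobi

noncomputable section

/-! ### The machine -/

/-- Memory: one real word per address. -/
abbrev Mem := ℕ → ℝ

/-- Where the entries of a matrix are stored: entry `(i, j)` is at address `X i j`.
Index arithmetic is not a floating point operation and is free. -/
abbrev Loc := ℕ → ℕ → ℕ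

/-- Row-major storage with row length `s`, starting at address `base`. -/
def dense (base s : ℕ) : Loc := fun i j => base + i * s + j

/-- The transposed matrix, without moving data. -/
def Loc.flip (X : Loc) : Loc := fun i j => X j i

/-- The submatrix that starts in row `r` and column `c`. -/
def Loc.shift (X : Loc) (r c : ℕ) : Loc := fun i j => X (r + i) (c + j)

/-- The four arithmetic operations on words (with `x / 0 = 0`). -/
inductive Arith
  | plus
  | minus
  | times
  | over

/-- Value of an arithmetic operation. -/
def Arith.eval : Arith → ℝ → ℝ → ℝ
  | .plus, x, y => x + y
  | .minus, x, y => x - y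
  | .times, x, y => x * y
  | .over, x, y => x / y

/-- A direct symmetric eigensolver: it returns an exact spectral decomposition of every symmetric
matrix, and is charged `flops k` arithmetic operations on a `k × k` matrix (any function of `k`;
in practice `O(k ^ 3)`). -/
structure DirectSolver where
  vectors : ∀ k : ℕ, Matrix (Fin k) (Fin k) ℝ → Matrix (Fin k) (Fin k) ℝ
  values : ∀ k : ℕ, Matrix (Fin k) (Fin k) ℝ → Fin k → ℝ
  orthogonal : ∀ (k : ℕ) (A : Matrix (Fin k) (Fin k) ℝ), A.IsSymm →
    vectors k A ∈ Matrix.orthogonalGroup (Fin k) ℝ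
  decomposes : ∀ (k : ℕ) (A : Matrix (Fin k) (Fin k) ℝ), A.IsSymm →
    A = vectors k A * Matrix.diagonal (values k A) * (vectors k A).transpose
  flops : ℕ → ℕ

/-- Instructions. `eigen k A Q` diagonalizes the `k × k` matrix stored at `A` directly: `A` is
replaced by the diagonal matrix of eigenvalues and `Q` by the matrix of eigenvectors. -/
inductive Instr
  | const (dst : ℕ) (c : ℝ)
  | copy (dst src : ℕ)
  | scale (dst : ℕ) (c : ℝ) (src : ℕ)
  | abs (dst src : ℕ)
  | arith (o : Arith) (dst a b : ℕ)
  | eigen (k : ℕ) (A Q : Loc)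

/-- The `k × k` matrix stored at `X`. -/
def readBlock (k : ℕ) (X : Loc) (m : Mem) : Matrix (Fin k) (Fin k) ℝ :=
  Matrix.of fun i j => m (X i j)

/-- Store a `k × k` matrix at `X`. -/
def writeBlock (k : ℕ) (X : Loc) (B : Matrix (Fin k) (Fin k) ℝ) (m : Mem) : Mem :=
  (List.finRange k).foldl (fun m (i : Fin k) =>
    (List.finRange k).foldl (fun m (j : Fin k) => Function.update m (X i j) (B i j)) m) m

/-- Effect of an instruction on the memory. -/
def Instr.exec (S : DirectSolver) : Instr → Mem → Mem
  | .const dst c, m => Function.update m dst c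
  | .copy dst src, m => Function.update m dst (m src)
  | .scale dst c src, m => Function.update m dst (c * m src)
  | .abs dst src, m => Function.update m dst |m src|
  | .arith o dst a b, m => Function.update m dst (o.eval (m a) (m b))
  | .eigen k A Q, m =>
      writeBlock k A (Matrix.diagonal (S.values k (readBlock k A m)))
        (writeBlock k Q (S.vectors k (readBlock k A m)) m)

/-- Arithmetic operations charged for an instruction; moving data is not arithmetic. -/
def Instr.flops (S : DirectSolver) : Instr → ℕ
  | .const _ _ => 0
  | .copy _ _ => 0
  | .scale _ _ _ => 1
  | .abs _ _ => 1
  | .arith _ _ _ _ => 1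
  | .eigen k _ _ => S.flops k

/-- The words that have to be in fast memory while an instruction is carried out. -/
def Instr.touches : Instr → Finset ℕ
  | .const dst _ => {dst}
  | .copy dst src => {dst, src}
  | .scale dst _ src => {dst, src}
  | .abs dst src => {dst, src}
  | .arith _ dst a b => {dst, a, b}
  | .eigen k A Q =>
      (Finset.range k ×ˢ Finset.range k).image (fun p => A p.1 p.2) ∪
        (Finset.range k ×ˢ Finset.range k).image (fun p => Q p.1 p.2)

/-- Programs: `step` carries out an instruction, `test a b` branches on whether the word at
address `a` is smaller than the word at address `b`. -/
inductive Prog (α : Type) : Type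
  | ret (x : α) : Prog α
  | step (i : Instr) (next : Prog α) : Prog α
  | test (a b : ℕ) (next : Bool → Prog α) : Prog α

/-- Sequential composition. -/
def Prog.bind {α β : Type} : Prog α → (α → Prog β) → Prog β
  | .ret x, g => g x
  | .step i p, g => .step i (p.bind g)
  | .test a b p, g => .test a b fun c => (p c).bind g

instance : Monad Prog where
  pure := Prog.ret
  bind := Prog.bind

/-- Record of an execution: result, final memory, number of arithmetic operations, and the words
used by the successive instructions. -/
structure Run (α : Type) where
  result : α
  mem : Mem
  flops : ℕ
  trace : List (Finset ℕ)

open Classical in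
/-- Execution of a program; a comparison counts as one arithmetic operation. -/
def Prog.run {α : Type} (S : DirectSolver) : Prog α → Mem → Run α
  | .ret x, m => ⟨x, m, 0, []⟩
  | .step i p, m =>
      let r := p.run S (i.exec S m)
      ⟨r.result, r.mem, i.flops S + r.flops, i.touches :: r.trace⟩
  | .test a b p, m =>
      let r := (p (decide (m a < m b))).run S m
      ⟨r.result, r.mem, 1 + r.flops, {a, b} :: r.trace⟩

/-- `Moves M c t w`: starting with the set `c` of words in a fast memory of size `M`, the
instructions with footprints `t` can be carried out, ending with an empty fast memory, by moving
`w` words between slow and fast memory. All words of a footprint have to be in fast memory at the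
same time, and bringing a word in and moving a word out cost one each. -/
inductive Moves (M : ℕ) : Finset ℕ → List (Finset ℕ) → ℕ → Prop
  | done : Moves M ∅ [] 0
  | use {c u : Finset ℕ} {t : List (Finset ℕ)} {w : ℕ} :
      u ⊆ c → Moves M c t w → Moves M c (u :: t) w
  | load {c : Finset ℕ} {t : List (Finset ℕ)} {w : ℕ} (a : ℕ) :
      a ∉ c → c.card < M → Moves M (insert a c) t w → Moves M c t (w + 1)
  | evict {c : Finset ℕ} {t : List (Finset ℕ)} {w : ℕ} (a : ℕ) :
      a ∈ c → Moves M (c.erase a) t w → Moves M c t (w + 1)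

/-! ### Elementary programs -/

/-- A single instruction as a program. -/
def emit (i : Instr) : Prog Unit := .step i (.ret ())

/-- A comparison as a program. -/
def less (a b : ℕ) : Prog Bool := .test a b .ret

/-- Run `body x` for the members `x` of a list, in order. -/
def each {β : Type} : List β → (β → Prog Unit) → Prog Unit
  | [], _ => pure ()
  | x :: xs, body => do
      body x
      each xs body

/-- Run a program or do nothing. -/
def optionally : Bool → Prog Unit → Prog Unit
  | true, p => p
  | false, _ => pure ()

/-- Run `body i j` for all `i < r` and `j < c`. -/
def entries (r c : ℕ) (body : ℕ → ℕ → Prog Unit) : Prog Unit :=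
  each (List.range r) fun i => each (List.range c) fun j => body i j

/-- `X := Y` for `r × c` matrices. -/
def copyBlock (r c : ℕ) (X Y : Loc) : Prog Unit :=
  entries r c fun i j => emit (.copy (X i j) (Y i j))

/-- `X := I` for a `k × k` matrix. -/
def setIdentity (k : ℕ) (X : Loc) : Prog Unit :=
  entries k k fun i j => emit (.const (X i j) (if i = j then 1 else 0))

/-- Number of pieces of length at most `s` into which a range of length `n` is cut. -/
def pieces (n s : ℕ) : ℕ := (n + s - 1) / s

/-! ### Strassen-like matrix multiplication -/

/-- A bilinear algorithm that multiplies `dim × dim` matrices with `rank` multiplications: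
`C i j = ∑ l, W l i j * (∑ U l p q * A p q) * (∑ V l p q * B p q)`. The equation is the
(coefficientwise) correctness, so it also holds for matrices of blocks. -/
structure BilinearAlg where
  dim : ℕ
  two_le : 2 ≤ dim
  rank : ℕ
  U : Fin rank → Fin dim → Fin dim → ℝ
  V : Fin rank → Fin dim → Fin dim → ℝ
  W : Fin rank → Fin dim → Fin dim → ℝ
  correct : ∀ p q p' q' i j : Fin dim,
    ∑ l, U l p q * V l p' q' * W l i j = if p = i ∧ q = p' ∧ q' = j then 1 else 0

/-- A matrix operand: a stored `rows × cols` matrix; entries beyond it are read as zero. -/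
structure Operand where
  rows : ℕ
  cols : ℕ
  loc : Loc

/-- `X (i, j) := ∑ p q, u p q * Y (p * t + i, q * t + j)` for `i, j < t`: a linear combination of
the `t × t` blocks of `Y`. The word at `tmp` is scratch. -/
def combine {d : ℕ} (t : ℕ) (u : Fin d → Fin d → ℝ) (Y : Operand) (X : Loc) (tmp : ℕ) :
    Prog Unit :=
  entries t t fun i j => do
    emit (.const (X i j) 0)
    each (List.finRange d) fun p => each (List.finRange d) fun q =>
      if p * t + i < Y.rows ∧ q * t + j < Y.cols then do
        emit (.scale tmp (u p q) (Y.loc (p * t + i) (q * t + j)))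
        emit (.arith .plus (X i j) (X i j) tmp)
      else pure ()

/-- `T (p * t + i, q * t + j) += u p q * X (i, j)` for the entries of the `s × s` matrix `T`. -/
def scatter {d : ℕ} (s t : ℕ) (u : Fin d → Fin d → ℝ) (X T : Loc) (tmp : ℕ) : Prog Unit :=
  entries t t fun i j =>
    each (List.finRange d) fun p => each (List.finRange d) fun q =>
      if p * t + i < s ∧ q * t + j < s then do
        emit (.scale tmp (u p q) (X i j))
        emit (.arith .plus (T (p * t + i) (q * t + j)) (T (p * t + i) (q * t + j)) tmp)
      else pure ()

theorem pieces_lt {s d : ℕ} (hd : 2 ≤ d) (hs : ¬ s ≤ 1) : pieces s d < s := by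
  unfold pieces
  rw [Nat.div_lt_iff_lt_mul (by omega)]
  obtain ⟨e, rfl⟩ : ∃ e, d = e + 2 := ⟨d - 2, by omega⟩
  obtain ⟨k, rfl⟩ : ∃ k, s = k + 2 := ⟨s - 2, by omega⟩
  have : 0 ≤ k * e := Nat.zero_le _
  have h : (k + 2) * (e + 2) = k * e + 2 * k + 2 * e + 4 := by ring
  omega

/-- Recursive matrix multiplication `T := A * B`, where `T` is `s × s` and the operands are at most
`s × s`; all addresses from `ws` on are workspace. The operands are cut into `dim × dim` blocks
(padded by zeros), and each of the `rank` products of block combinations is computed recursively. -/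
def mul (mm : BilinearAlg) (s : ℕ) (A B : Operand) (T : Loc) (ws : ℕ) : Prog Unit :=
  if h : s ≤ 1 then
    if 0 < A.rows ∧ 0 < A.cols ∧ 0 < B.rows ∧ 0 < B.cols then
      emit (.arith .times (T 0 0) (A.loc 0 0) (B.loc 0 0))
    else emit (.const (T 0 0) 0)
  else
    let t := pieces s mm.dim
    let X := dense (ws + 1) t
    let Y := dense (ws + 1 + t * t) t
    let Z := dense (ws + 1 + 2 * (t * t)) t
    do
      entries s s fun i j => emit (.const (T i j) 0)
      each (List.finRange mm.rank) fun l => do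
        combine t (mm.U l) A X ws
        combine t (mm.V l) B Y ws
        mul mm t ⟨t, t, X⟩ ⟨t, t, Y⟩ Z (ws + 1 + 3 * (t * t))
        scatter s t (mm.W l) Z T ws
termination_by s
decreasing_by exact pieces_lt mm.two_le h

/-- `X := G * X` for an `s × s` matrix `G` and an `s × w` matrix `X`, done with `s × s`
multiplications on the successive groups of `s` columns of `X`. -/
def applyLeft (mm : BilinearAlg) (s w : ℕ) (G X : Loc) (ws : ℕ) : Prog Unit :=
  each (List.range (pieces w s)) fun c => do
    mul mm s ⟨s, s, G⟩ ⟨s, min s (w - c * s), X.shift 0 (c * s)⟩ (dense ws s) (ws + s * s)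
    copyBlock s (min s (w - c * s)) (X.shift 0 (c * s)) (dense ws s)

/-- `C := C - A * B` for `C` of size `m × n`, `A` of size `m × k` and `B` of size `k × n`, done
with `s × s` multiplications (for `k ≤ s`). -/
def mulSub (mm : BilinearAlg) (s m k n : ℕ) (C A B : Loc) (ws : ℕ) : Prog Unit :=
  entries (pieces m s) (pieces n s) fun a c => do
    mul mm s ⟨min s (m - a * s), k, A.shift (a * s) 0⟩ ⟨k, min s (n - c * s), B.shift 0 (c * s)⟩
      (dense ws s) (ws + s * s)
    entries (min s (m - a * s)) (min s (n - c * s)) fun i j =>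
      emit (.arith .minus (C (a * s + i) (c * s + j)) (C (a * s + i) (c * s + j)) (dense ws s i j))

/-! ### Recursive LU factorization with partial pivoting -/

/-- `B := L⁻¹ * B` for `B` of size `h × w`, where `L` is the unit lower triangular `h × h` matrix
whose strictly lower part is stored at `L`. -/
def trisolve (mm : BilinearAlg) (h w : ℕ) (L B : Loc) (ws : ℕ) : Prog Unit :=
  if _h : h ≤ 1 then pure ()
  else do
    trisolve mm (h / 2) w L B ws
    mulSub mm (h - h / 2) (h - h / 2) (h / 2) w (B.shift (h / 2) 0) (L.shift (h / 2) 0) B ws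
    trisolve mm (h - h / 2) w (L.shift (h / 2) (h / 2)) (B.shift (h / 2) 0) ws
termination_by h

/-- Row index of a largest entry in absolute value: scans the rows in the list, `best` is the
current candidate and the word at `tmp` holds its absolute value. -/
def argMax (Y : Loc) (col tmp : ℕ) : ℕ → List ℕ → Prog ℕ
  | best, [] => pure best
  | best, i :: is => do
      emit (.abs (tmp + 1) (Y i col))
      let larger ← less tmp (tmp + 1)
      if larger then do
        emit (.copy tmp (tmp + 1))
        argMax Y col tmp i is
      else argMax Y col tmp best is

/-- Swap rows `i` and `i'` of a matrix with `c` columns. -/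
def swapRows (c : ℕ) (X : Loc) (i i' tmp : ℕ) : Prog Unit :=
  each (List.range c) fun j => do
    emit (.copy tmp (X i j))
    emit (.copy (X i j) (X i' j))
    emit (.copy (X i' j) tmp)

/-- Bring a largest entry (in absolute value) of column `off` among the rows `off, …, m - 1` of the
`m × n` matrix `Y` to row `off`. The row interchange is applied to the full rows of `Y` and to the
`m × m` permutation matrix `P`. -/
def pivotRow (m n : ℕ) (Y P : Loc) (ws off : ℕ) : Prog Unit := do
  emit (.abs ws (Y off off))
  let i ← argMax Y off ws off (List.range' (off + 1) (m - (off + 1)))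
  if i = off then pure ()
  else do
    swapRows n Y off i ws
    swapRows m P off i ws

/-- Recursive LU factorization with partial pivoting of the columns `off, …, off + w - 1` of the
rows `off, …, m - 1` of the `m × n` matrix `Y`, in place (`U` on and above the diagonal, the unit
lower trapezoidal `L` below it). Row interchanges are applied at once to all of `Y` and `P`, so the
factors of the two halves need not be permuted afterwards. -/
def lupp (mm : BilinearAlg) (m n : ℕ) (Y P : Loc) (ws off w : ℕ) : Prog Unit := do
  pivotRow m n Y P ws off
  if _h : w ≤ 1 then
    each (List.range' (off + 1) (m - (off + 1))) fun r =>
      emit (.arith .over (Y r off) (Y r off) (Y off off))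
  else do
    lupp mm m n Y P ws off (w / 2)
    trisolve mm (w / 2) (w - w / 2) (Y.shift off off) (Y.shift off (off + w / 2)) ws
    mulSub mm (w - w / 2) (m - (off + w / 2)) (w / 2) (w - w / 2)
      (Y.shift (off + w / 2) (off + w / 2)) (Y.shift (off + w / 2) off)
      (Y.shift off (off + w / 2)) ws
    lupp mm m n Y P ws (off + w / 2) (w - w / 2)
termination_by w

/-! ### Recursive Jacobi -/

/-- How the distance from diagonal form is measured: by the largest off-diagonal absolute value,
or by the sum of the squares of the off-diagonal entries. -/
inductive OffMeasure
  | largest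
  | squares

/-- Does the off-diagonal part of the `k × k` matrix at `X` exceed the tolerance `τ`? -/
def exceeds (μ : OffMeasure) (τ : ℝ) (k : ℕ) (X : Loc) (ws : ℕ) : Prog Bool := do
  emit (.const ws 0)
  entries k k fun i j =>
    if i = j then pure ()
    else do
      emit (.abs (ws + 1) (X i j))
      match μ with
      | .largest => do
          let larger ← less ws (ws + 1)
          if larger then emit (.copy ws (ws + 1))
      | .squares => do
          emit (.arith .times (ws + 1) (ws + 1) (ws + 1))
          emit (.arith .plus ws ws (ws + 1))
  emit (.const (ws + 1) τ)
  less (ws + 1) ws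

/-- The off-diagonal block positions `(I, J)` with `I < J < N`, in column-cyclic order. -/
def blockPairs (N : ℕ) : List (ℕ × ℕ) :=
  (List.range N).flatMap fun J => (List.range J).map fun I => (I, J)

/-- The choices that recursive Jacobi leaves open. They may differ between the recursive calls; a
call is identified by its `path`, the list of block pairs (innermost first) that lead to it. -/
structure Choices where
  /-- order in which the off-diagonal blocks are visited, for `N` block rows -/
  order : List (ℕ × ℕ) → ℕ → List (ℕ × ℕ)
  order_perm : ∀ path N, (order path N).Perm (blockPairs N)
  /-- is the optional pivoting step carried out? -/
  pivot : List (ℕ × ℕ) → Bool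
  /-- how the distance from diagonal form is measured, -/
  measure : OffMeasure
  /-- and the tolerance for it (a negative one means that every block is rotated) -/
  tol : List (ℕ × ℕ) → ℝ

/-- Row of the full matrix that is row `i` of the block rows `I` and `J`, of block size `b`. -/
def pairIndex (b I J : ℕ) (i : ℕ) : ℕ := if i < b then I * b + i else J * b + (i - b)

/-- The pivoting step for an `s × s` rotation `R`: factor the transpose of its first `b` rows by
pivoted LU, with permutation matrix `P`, and replace `R` by `R Pᵀ`. -/
def pivotColumns (mm : BilinearAlg) (b s : ℕ) (R : Loc) (ws : ℕ) : Prog Unit := do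
  let P := dense ws s
  let Y := dense (ws + s * s) b
  setIdentity s P
  copyBlock s b Y R.flip
  lupp mm s b Y P (ws + 2 * (s * s)) 0 b
  applyLeft mm s s P R.flip (ws + 2 * (s * s))

/-- `A := Rᵀ A R` and `Q := Q R` for `n × n` matrices `A` and `Q`, where the `s × s` rotation `R` acts
on the rows and columns `idx`. -/
def rotate (mm : BilinearAlg) (n s : ℕ) (idx : ℕ → ℕ) (A Q R : Loc) (ws : ℕ) : Prog Unit := do
  applyLeft mm s n R.flip (fun i j => A (idx i) j) ws
  applyLeft mm s n R.flip (fun i j => A j (idx i)) ws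
  applyLeft mm s n R.flip (fun i j => Q j (idx i)) ws

/-- One sweep of recursive Jacobi on the `n × n` matrix `A` with log block size `f`; every recursive
call is one sweep as well. The block size is `b = ⌊n ^ f⌋`, and the last block is smaller if
`b` does not divide `n`. On return `A` holds the transformed matrix and `Q` the accumulated
orthogonal matrix; the result says whether the off-diagonal part is within the tolerance. -/
def sweep (mm : BilinearAlg) (f : ℝ) (nthr : ℕ) (o : Choices) (path : List (ℕ × ℕ)) (n : ℕ)
    (A Q : Loc) (ws : ℕ) : Prog Bool :=
  let b := ⌊(n : ℝ) ^ f⌋₊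
  if _h : n < nthr ∨ n ≤ 2 * b then do
    setIdentity n Q
    emit (.eigen n A Q)
    pure true
  else do
    setIdentity n Q
    each (o.order path (pieces n b)) fun IJ => do
      let s := b + min b (n - IJ.2 * b)
      let idx := pairIndex b IJ.1 IJ.2
      let B := dense ws s
      let R := dense (ws + s * s) s
      copyBlock s s B (fun i j => A (idx i) (idx j))
      let far ← exceeds o.measure (o.tol (IJ :: path)) s B (ws + 2 * (s * s))
      if far then do
        let _ ← sweep mm f nthr o (IJ :: path) s B R (ws + 2 * (s * s))
        optionally (o.pivot (IJ :: path)) (pivotColumns mm b s R (ws + 2 * (s * s)))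
        rotate mm n s idx A Q R (ws + 2 * (s * s))
    let far ← exceeds o.measure (o.tol path) n A ws
    pure (!far)
termination_by n
decreasing_by omega

/-- Memory that holds the matrix `A`, row by row, from address `0` on. -/
def inputMem {n : ℕ} (A : Matrix (Fin n) (Fin n) ℝ) : Mem := fun a =>
  if h : a < n * n then
    A ⟨a / n, Nat.div_lt_of_lt_mul h⟩
      ⟨a % n, Nat.mod_lt _ (Nat.pos_of_ne_zero fun h0 => by simp [h0] at h)⟩
  else 0

/-- Execution of one sweep of recursive Jacobi on the input `A`. -/
def sweepRun (mm : BilinearAlg) (f : ℝ) (nthr : ℕ) (S : DirectSolver) (o : Choices) {n : ℕ}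
    (A : Matrix (Fin n) (Fin n) ℝ) : Run Bool :=
  (sweep mm f nthr o [] n (dense 0 n) (dense (n * n) n) (2 * (n * n))).run S (inputMem A)

end

end RecJacobi

namespace RecJacobi

/-! The arithmetic and the communication bound are one statement about an abstract `CostModel`: a
charge that adds up under concatenation and is at most 6 per elementary instruction. The only
model-dependent inputs are a cutoff `x` up to which products are cheap (`SmallMul`) and a bound on
direct diagonalizations. Flops use `x = 1`; moves use `x ≈ √(M/6)`, since below that size operands,
result and workspace fit in fast memory together and are loaded and evicted only once.

Stopping the Strassen recursion at the cutoff gives `s ^ ω / x ^ (ω - 2) + s ^ 2` per product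
(`exists_mul_costs`). A sweep visits about `n ^ (2 (1 - f))` block pairs, and each rotation takes
about `n ^ (1 - f)` products of size `n ^ f`. This yields the main term `n ^ γ / x ^ (ω - 2)` with
`γ = 3 (1 - f) + ω f`. Pivoting is needed only once per pair, so the crude bound `s ^ ω`, without
any gain from `x`, is already of lower order (`exists_pivotColumns_costs`).

It remains to solve `T n ≤ C (n ^ (2 (1 - f)) T (2 n ^ f) + n ^ γ / X + n ^ δ)` with `δ < γ`
(`eventually_of_recursion`). Since `γ > 2`, inserting any bound `K n ^ γ` on the right makes the
recursive term `o(n ^ γ)`. Hence neither `K`, which absorbs the direct solver and the threshold, nor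
`X` enters the final constant.

The lower bound on the threshold gives `2 n ^ f < n` from there on, so direct diagonalization occurs
only below the threshold. The upper bound makes its two operands fit in fast memory. -/

/-- A way of charging executions: `rel k t w` says that an execution with `k` arithmetic operations
and trace `t` has cost at most `w`. -/
structure CostModel where
  rel : ℕ → List (Finset ℕ) → ℝ → Prop
  nil : rel 0 [] 0
  append : ∀ {k k' t t' w w'}, rel k t w → rel k' t' w' → rel (k + k') (t ++ t') (w + w')
  mono : ∀ {k t w w'}, rel k t w → w ≤ w' → rel k t w'
  -- Three words loaded and three evicted make 6 moves; this also covers a single flop.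
  basic : ∀ {k u}, k ≤ 1 → u.card ≤ 3 → rel k [u] 6

/-- Every execution of the program has cost at most `w`. -/
def Costs (Φ : CostModel) (S : DirectSolver) {α : Type} (p : Prog α) (w : ℝ) : Prop :=
  ∀ m, Φ.rel (p.run S m).flops (p.run S m).trace w

/-! ### Costs of composed and elementary programs -/

theorem Prog.run_bind {α β : Type} (S : DirectSolver) (p : Prog α) (g : α → Prog β) (m : Mem) :
    ((p.bind g).run S m).flops
        = (p.run S m).flops + ((g (p.run S m).result).run S (p.run S m).mem).flops ∧
      ((p.bind g).run S m).trace
        = (p.run S m).trace ++ ((g (p.run S m).result).run S (p.run S m).mem).trace := by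
  induction p generalizing m with
  | ret x => simp [Prog.bind, Prog.run]
  | step i p ih =>
    obtain ⟨h1, h2⟩ := ih (i.exec S m)
    simp only [Prog.bind, Prog.run, h1, h2]
    exact ⟨by ring, rfl⟩
  | test a b p ih =>
    classical
    obtain ⟨h1, h2⟩ := ih (decide (m a < m b)) m
    simp only [Prog.bind, Prog.run]
    refine ⟨?_, ?_⟩
    · convert congrArg (1 + ·) h1 using 1
      ring
    · exact congrArg (List.cons {a, b}) h2

section Costs

variable {Φ : CostModel} {S : DirectSolver} {α β : Type}

theorem Costs.mono {p : Prog α} {w w' : ℝ} (h : Costs Φ S p w) (hw : w ≤ w') : Costs Φ S p w' :=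
  fun m => Φ.mono (h m) hw

theorem Costs.pure (x : α) {w : ℝ} (hw : 0 ≤ w) : Costs Φ S (pure x : Prog α) w :=
  fun _ => Φ.mono Φ.nil hw

/-- Cost bounds hold for all initial memories and the continuation is bounded for all intermediate
results, so branches and pivot choices require no knowledge of the computed values. -/
theorem Costs.bind {p : Prog α} {g : α → Prog β} {w w' : ℝ} (hp : Costs Φ S p w)
    (hg : ∀ a, Costs Φ S (g a) w') : Costs Φ S (p >>= g) (w + w') := by
  intro m
  obtain ⟨h1, h2⟩ := Prog.run_bind S p g m
  change Φ.rel ((p.bind g).run S m).flops ((p.bind g).run S m).trace _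
  rw [h1, h2]
  exact Φ.append (hp m) (hg _ _)

theorem Costs.emit {i : Instr} (hk : i.flops S ≤ 1) (hi : i.touches.card ≤ 3) :
    Costs Φ S (emit i) 6 :=
  fun _ => Φ.basic hk hi

theorem Costs.const (a : ℕ) (c : ℝ) : Costs Φ S (RecJacobi.emit (.const a c)) 6 :=
  Costs.emit (by simp [Instr.flops]) (by simp [Instr.touches])

theorem Costs.copy (a b : ℕ) : Costs Φ S (RecJacobi.emit (.copy a b)) 6 :=
  Costs.emit (by simp [Instr.flops]) ((Finset.card_le_two).trans (by norm_num))

theorem Costs.scale (a : ℕ) (c : ℝ) (b : ℕ) : Costs Φ S (RecJacobi.emit (.scale a c b)) 6 :=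
  Costs.emit (by simp [Instr.flops]) ((Finset.card_le_two).trans (by norm_num))

theorem Costs.abs (a b : ℕ) : Costs Φ S (RecJacobi.emit (.abs a b)) 6 :=
  Costs.emit (by simp [Instr.flops]) ((Finset.card_le_two).trans (by norm_num))

theorem Costs.arith (o : Arith) (a b c : ℕ) : Costs Φ S (RecJacobi.emit (.arith o a b c)) 6 :=
  Costs.emit (by simp [Instr.flops]) Finset.card_le_three

theorem Costs.less (a b : ℕ) : Costs Φ S (less a b) 6 :=
  fun _ => Φ.basic le_rfl ((Finset.card_le_two).trans (by norm_num))

theorem Costs.each {l : List β} {body : β → Prog Unit} {w : ℝ}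
    (h : ∀ x ∈ l, Costs Φ S (body x) w) : Costs Φ S (each l body) (l.length * w) := by
  induction l with
  | nil => exact Costs.pure _ (by simp)
  | cons x xs ih =>
    refine ((h x (by simp)).bind fun _ => ih fun y hy => h y (by simp [hy])).mono ?_
    push_cast [List.length_cons]
    linarith

theorem Costs.entries {r c : ℕ} {body : ℕ → ℕ → Prog Unit} {w : ℝ}
    (h : ∀ i j, i < r → j < c → Costs Φ S (body i j) w) :
    Costs Φ S (entries r c body) (r * (c * w)) := by
  have := Costs.each (Φ := Φ) (S := S) (l := List.range r)
    (body := fun i => RecJacobi.each (List.range c) fun j => body i j) (w := c * w) fun i hi => by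
      simpa using Costs.each (l := List.range c) (body := fun j => body i j) fun j hj =>
        h i j (List.mem_range.1 hi) (List.mem_range.1 hj)
  simpa [RecJacobi.entries] using this

theorem Costs.optionally {p : Prog Unit} {w : ℝ} (hw : 0 ≤ w) (h : Costs Φ S p w) (t : Bool) :
    Costs Φ S (optionally t p) w := by
  cases t
  · exact Costs.pure _ hw
  · exact h

theorem Costs.copyBlock (r c : ℕ) (X Y : Loc) :
    Costs Φ S (copyBlock r c X Y) (r * (c * 6)) :=
  Costs.entries fun _ _ _ _ => Costs.copy _ _

theorem Costs.setIdentity (k : ℕ) (X : Loc) : Costs Φ S (setIdentity k X) (k * (k * 6)) :=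
  Costs.entries fun _ _ _ _ => Costs.const _ _

theorem Costs.combine {d : ℕ} (t : ℕ) (u : Fin d → Fin d → ℝ) (Y : Operand) (X : Loc) (tmp : ℕ) :
    Costs Φ S (combine t u Y X tmp) (t * (t * (6 + d * (d * 12)))) := by
  refine Costs.entries fun i j _ _ => (Costs.const _ _).bind fun _ => ?_
  simpa using Costs.each (l := List.finRange d) (w := d * 12) fun p _ => by
    simpa using Costs.each (l := List.finRange d) (w := 12) fun q _ => by
      split_ifs
      · exact ((Costs.scale _ _ _).bind fun _ => Costs.arith _ _ _ _).mono (by norm_num)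
      · exact Costs.pure _ (by norm_num)

theorem Costs.scatter {d : ℕ} (s t : ℕ) (u : Fin d → Fin d → ℝ) (X T : Loc) (tmp : ℕ) :
    Costs Φ S (scatter s t u X T tmp) (t * (t * (d * (d * 12)))) := by
  refine Costs.entries fun i j _ _ => ?_
  simpa using Costs.each (l := List.finRange d) (w := d * 12) fun p _ => by
    simpa using Costs.each (l := List.finRange d) (w := 12) fun q _ => by
      split_ifs
      · exact ((Costs.scale _ _ _).bind fun _ => Costs.arith _ _ _ _).mono (by norm_num)
      · exact Costs.pure _ (by norm_num)

theorem Costs.swapRows (c : ℕ) (X : Loc) (i i' tmp : ℕ) :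
    Costs Φ S (swapRows c X i i' tmp) (c * 18) := by
  simpa [RecJacobi.swapRows] using Costs.each (l := List.range c) (w := 18) fun j _ =>
    ((Costs.copy _ _).bind fun _ => (Costs.copy _ _).bind fun _ => Costs.copy _ _).mono
      (by norm_num)

theorem Costs.argMax (Y : Loc) (col tmp best : ℕ) (l : List ℕ) :
    Costs Φ S (argMax Y col tmp best l) (l.length * 18) := by
  induction l generalizing best with
  | nil => exact Costs.pure _ (by simp)
  | cons i is ih =>
    refine ((Costs.abs _ _).bind (w' := 12 + is.length * 18) fun _ =>
      ((Costs.less _ _).bind (w' := 6 + is.length * 18) fun c => ?_).mono (by linarith)).mono ?_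
    · split_ifs
      · exact (Costs.copy _ _).bind fun _ => ih _
      · exact (ih _).mono (by linarith)
    · push_cast [List.length_cons]
      linarith

theorem Costs.pivotRow {m n off : ℕ} (Y P : Loc) (ws : ℕ) :
    Costs Φ S (pivotRow m n Y P ws off) (6 + 36 * m + 18 * n) := by
  refine ((Costs.abs _ _).bind fun _ => (Costs.argMax _ _ _ _ _).bind
    (w' := n * 18 + m * 18) fun i => ?_).mono ?_
  · split_ifs
    · exact Costs.pure _ (by positivity)
    · exact (Costs.swapRows _ _ _ _ _).bind fun _ => Costs.swapRows _ _ _ _ _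
  · have : ((m - (off + 1) : ℕ) : ℝ) ≤ m := by exact_mod_cast Nat.sub_le _ _
    simp only [List.length_range']
    linarith

theorem Costs.exceeds (μ : OffMeasure) (τ : ℝ) (k : ℕ) (X : Loc) (ws : ℕ) :
    Costs Φ S (exceeds μ τ k X ws) (18 + k * (k * 18)) := by
  refine ((Costs.const _ _).bind fun _ => (Costs.entries (w := 18) fun i j _ _ => ?_).bind fun _ =>
    (Costs.const _ _).bind fun _ => Costs.less _ _).mono (by linarith)
  split_ifs
  · exact Costs.pure _ (by norm_num)
  · refine ((Costs.abs _ _).bind (w' := 12) fun _ => ?_).mono (by norm_num)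
    cases μ
    · refine ((Costs.less _ _).bind (w' := 6) fun c => ?_).mono (by norm_num)
      split_ifs
      · exact Costs.copy _ _
      · exact Costs.pure _ (by norm_num)
    · exact ((Costs.arith _ _ _ _).bind fun _ => Costs.arith _ _ _ _).mono (by norm_num)

end Costs

/-! ### Strassen-like multiplication with a cutoff -/

/-- Multiplications of size at most `x` cost no more than reading and writing
all the words that they use once. -/
def SmallMul (Φ : CostModel) (S : DirectSolver) (mm : BilinearAlg) (x : ℕ) : Prop :=
  ∀ (s : ℕ) (A B : Operand) (T : Loc) (ws : ℕ), 1 ≤ s → s ≤ x → A.rows ≤ s → A.cols ≤ s →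
    B.rows ≤ s → B.cols ≤ s → Costs Φ S (mul mm s A B T ws) (12 * (s : ℝ) ^ 2)

/-- A product of size one is a single instruction, so the cutoff 1 is available in every model. -/
theorem smallMul_one (Φ : CostModel) (S : DirectSolver) (mm : BilinearAlg) :
    SmallMul Φ S mm 1 := by
  intro s A B T ws h1 hs _ _ _ _
  obtain rfl : s = 1 := le_antisymm hs h1
  rw [mul, dif_pos le_rfl]
  split_ifs
  · exact (Costs.arith _ _ _ _).mono (by norm_num)
  · exact (Costs.const _ _).mono (by norm_num)

theorem pieces_le {n s y : ℕ} (hs : 1 ≤ s) (h : n ≤ y * s) : pieces n s ≤ y := by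
  unfold pieces
  rw [← Nat.lt_succ_iff, Nat.div_lt_iff_lt_mul (by omega), Nat.succ_mul]
  omega

theorem one_le_pieces {n s : ℕ} (hs : 1 ≤ s) (hn : 1 ≤ n) : 1 ≤ pieces n s := by
  unfold pieces
  rw [Nat.le_div_iff_mul_le (by omega)]
  omega

theorem pieces_le_div_add_one (n : ℕ) {s : ℕ} (hs : 1 ≤ s) :
    (pieces n s : ℝ) ≤ (n : ℝ) / s + 1 := by
  have hs' : (0 : ℝ) < s := by exact_mod_cast hs
  have h : pieces n s * s ≤ n + s - 1 := Nat.div_mul_le_self _ _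
  have h2 : ((pieces n s * s : ℕ) : ℝ) ≤ n + s := by
    exact_mod_cast h.trans (Nat.sub_le _ _)
  rw [div_add_one hs'.ne', le_div_iff₀ hs']
  exact_mod_cast h2

/-- One level of the recursion: clearing the target costs `6 s ^ 2`; each of the `rank` products
adds two combinations and one scatter, all quadratic in the block size, besides its recursive cost
`β`. -/
theorem Costs.mul_step {Φ : CostModel} {S : DirectSolver} {mm : BilinearAlg} {s : ℕ} (hs : 2 ≤ s)
    {β : ℝ} (h : ∀ (A B : Operand) (T : Loc) (ws : ℕ), A.rows ≤ pieces s mm.dim →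
      A.cols ≤ pieces s mm.dim → B.rows ≤ pieces s mm.dim → B.cols ≤ pieces s mm.dim →
      Costs Φ S (mul mm (pieces s mm.dim) A B T ws) β) (A B : Operand) (T : Loc) (ws : ℕ) :
    Costs Φ S (mul mm s A B T ws)
      ((6 + mm.rank * (12 + 36 * (mm.dim : ℝ) ^ 2)) * (s : ℝ) ^ 2 + mm.rank * β) := by
  have ht : (pieces s mm.dim : ℝ) ≤ s := by
    exact_mod_cast (pieces_lt mm.two_le (by omega : ¬ s ≤ 1)).le
  rw [mul, dif_neg (by omega)]
  refine ((Costs.entries fun i j _ _ => Costs.const _ _).bind fun _ =>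
    Costs.each (fun l _ => (Costs.combine _ _ _ _ _).bind fun _ =>
      (Costs.combine _ _ _ _ _).bind fun _ => (h _ _ _ _ le_rfl le_rfl le_rfl le_rfl).bind fun _ =>
        Costs.scatter _ _ _ _ _ _)).mono ?_
  rw [List.length_finRange]
  have h2 : (pieces s mm.dim : ℝ) ^ 2 ≤ (s : ℝ) ^ 2 := by gcongr
  calc _ = 6 * (s : ℝ) ^ 2
        + mm.rank * ((pieces s mm.dim : ℝ) ^ 2 * (12 + 36 * (mm.dim : ℝ) ^ 2) + β) := by ring
    _ ≤ 6 * (s : ℝ) ^ 2 + mm.rank * ((s : ℝ) ^ 2 * (12 + 36 * (mm.dim : ℝ) ^ 2) + β) := by gcongr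
    _ = _ := by ring

/-- A multiplication of size `s` costs `O(s ^ ω / x ^ (ω - 2) + s ^ 2)`, if those of size at
most `x` are small. -/
theorem exists_mul_costs {ω : ℝ} (hω : 2 < ω) (mm : BilinearAlg)
    (hmm : (mm.rank : ℝ) ≤ (mm.dim : ℝ) ^ ω) :
    ∃ C : ℝ, 0 < C ∧ ∀ (Φ : CostModel) (S : DirectSolver) (x : ℕ), 1 ≤ x → SmallMul Φ S mm x →
      ∀ (s : ℕ) (A B : Operand) (T : Loc) (ws : ℕ), 1 ≤ s → A.rows ≤ s → A.cols ≤ s →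
        B.rows ≤ s → B.cols ≤ s →
        Costs Φ S (mul mm s A B T ws) (C * ((s : ℝ) ^ ω / (x : ℝ) ^ (ω - 2) + (s : ℝ) ^ 2)) := by
  have hd : (2 : ℝ) ≤ mm.dim := by exact_mod_cast mm.two_le
  set D : ℝ := (mm.dim : ℝ) ^ ω with hD
  set q : ℝ := (mm.dim : ℝ) ^ 2 with hq
  set c : ℝ := 6 + mm.rank * (12 + 36 * q) with hc
  have hq1 : 1 ≤ q := one_le_pow₀ (by linarith)
  have hqD : q < D := by
    rw [hq, hD, ← Real.rpow_natCast]
    exact Real.rpow_lt_rpow_of_exponent_lt (by linarith) (by exact_mod_cast hω)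
  have hc0 : 0 ≤ c := by positivity
  -- With this `e`, the sequence `-e q ^ k` solves `u (k + 1) = D u k + c q ^ (k + 1)` exactly.
  -- Subtracting it in the induction hypothesis absorbs the quadratic overhead of every level.
  set e : ℝ := c * q / (D - q) with he
  have he0 : 0 ≤ e := div_nonneg (by positivity) (by linarith)
  have heq : e * (D - q) = c * q := div_mul_cancel₀ _ (by linarith)
  have key : ∀ (Φ : CostModel) (S : DirectSolver) (x : ℕ), 1 ≤ x → SmallMul Φ S mm x →
      ∀ (k s : ℕ) (A B : Operand) (T : Loc) (ws : ℕ), 1 ≤ s → s ≤ x * mm.dim ^ k →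
        A.rows ≤ s → A.cols ≤ s → B.rows ≤ s → B.cols ≤ s →
        Costs Φ S (mul mm s A B T ws) ((x : ℝ) ^ 2 * ((12 + e) * D ^ k - e * q ^ k)) := by
    intro Φ S x hx hsm k
    -- Below the cutoff the bound holds at every level `k`: as `q ^ k ≤ D ^ k` and `1 ≤ D ^ k`, the
    -- bracket is at least 12.
    have small : ∀ (k s : ℕ) (A B : Operand) (T : Loc) (ws : ℕ), 1 ≤ s → s ≤ x →
        A.rows ≤ s → A.cols ≤ s → B.rows ≤ s → B.cols ≤ s →
        Costs Φ S (mul mm s A B T ws) ((x : ℝ) ^ 2 * ((12 + e) * D ^ k - e * q ^ k)) := by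
      intro k s A B T ws h1 hs h2 h3 h4 h5
      refine (hsm s A B T ws h1 hs h2 h3 h4 h5).mono ?_
      have h6 : q ^ k ≤ D ^ k := by gcongr
      have h7 : 1 ≤ D ^ k := one_le_pow₀ (by linarith)
      have h8 : (s : ℝ) ^ 2 ≤ (x : ℝ) ^ 2 := by gcongr
      have h9 : 12 ≤ (12 + e) * D ^ k - e * q ^ k := by nlinarith
      nlinarith [sq_nonneg (s : ℝ)]
    induction k with
    | zero =>
      intro s A B T ws h1 hs
      exact small 0 s A B T ws h1 (by simpa using hs)
    | succ k ih =>
      intro s A B T ws h1 hs h2 h3 h4 h5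
      by_cases hsx : s ≤ x
      · exact small _ s A B T ws h1 hsx h2 h3 h4 h5
      have hd1 : 1 ≤ mm.dim := by have := mm.two_le; omega
      refine (Costs.mul_step (by omega) (fun A B T ws => ih _ A B T ws (one_le_pieces hd1 h1)
        (pieces_le hd1 (by rw [mul_assoc, ← pow_succ]; exact hs))) A B T ws).mono ?_
      have h6 : (s : ℝ) ≤ x * (mm.dim : ℝ) ^ (k + 1) := by exact_mod_cast hs
      have h7 : (s : ℝ) ^ 2 ≤ (x : ℝ) ^ 2 * q ^ (k + 1) := by
        calc (s : ℝ) ^ 2 ≤ (x * (mm.dim : ℝ) ^ (k + 1)) ^ 2 := by gcongr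
          _ = _ := by rw [hq]; ring
      have h8 : q ^ k ≤ D ^ k := by gcongr
      have h9 : 0 ≤ (12 + e) * D ^ k - e * q ^ k := by
        nlinarith [pow_nonneg (by linarith : 0 ≤ q) k]
      calc c * (s : ℝ) ^ 2 + mm.rank * ((x : ℝ) ^ 2 * ((12 + e) * D ^ k - e * q ^ k))
          ≤ c * ((x : ℝ) ^ 2 * q ^ (k + 1))
            + D * ((x : ℝ) ^ 2 * ((12 + e) * D ^ k - e * q ^ k)) := by gcongr
        _ = (x : ℝ) ^ 2 * ((12 + e) * D ^ (k + 1) - e * q ^ (k + 1)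
            + q ^ k * (c * q - e * (D - q))) := by ring
        _ = _ := by rw [heq]; ring
  have hD0 : 0 < D := by linarith
  refine ⟨(12 + e) * D + 12, by positivity, ?_⟩
  intro Φ S x hx hsm s A B T ws h1 h2 h3 h4 h5
  have hx0 : (0 : ℝ) < x := by exact_mod_cast hx
  by_cases hsx : s ≤ x
  · refine (hsm s A B T ws h1 hsx h2 h3 h4 h5).mono ?_
    have : 0 ≤ (s : ℝ) ^ ω / (x : ℝ) ^ (ω - 2) := by positivity
    have : 0 ≤ (12 + e) * D := by positivity
    nlinarith [sq_nonneg (s : ℝ)]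
  have hex : ∃ k, s ≤ x * mm.dim ^ k := by
    obtain ⟨k, hk⟩ := pow_unbounded_of_one_lt s (by have := mm.two_le; omega : 1 < mm.dim)
    exact ⟨k, hk.le.trans (Nat.le_mul_of_pos_left _ hx)⟩
  -- The least sufficient depth is positive because `s > x`. Its minimality gives `x * dim ^ k < s`,
  -- which turns `D ^ k` back into a power of `s / x`.
  obtain ⟨k, hk⟩ : ∃ k, Nat.find hex = k + 1 := by
    refine Nat.exists_eq_succ_of_ne_zero fun h0 => hsx ?_
    simpa [h0] using Nat.find_spec hex
  have hk1 : s ≤ x * mm.dim ^ (k + 1) := hk ▸ Nat.find_spec hex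
  have hk2 : x * mm.dim ^ k < s := not_le.1 (Nat.find_min hex (by omega : k < Nat.find hex))
  refine (key Φ S x hx hsm (k + 1) s A B T ws h1 hk1 h2 h3 h4 h5).mono ?_
  have h6 : (x : ℝ) * (mm.dim : ℝ) ^ k ≤ s := by exact_mod_cast hk2.le
  have h7 : (x : ℝ) ^ 2 * D ^ k ≤ (s : ℝ) ^ ω / (x : ℝ) ^ (ω - 2) := by
    rw [le_div_iff₀ (by positivity)]
    calc (x : ℝ) ^ 2 * D ^ k * (x : ℝ) ^ (ω - 2) = ((x : ℝ) * (mm.dim : ℝ) ^ k) ^ ω := by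
          rw [Real.mul_rpow hx0.le (by positivity), hD, ← Real.rpow_natCast (_ ^ ω) k,
            ← Real.rpow_natCast _ k, ← Real.rpow_mul (by positivity), ← Real.rpow_mul
            (by positivity), mul_comm ω, mul_right_comm, ← Real.rpow_natCast (x : ℝ) 2,
            ← Real.rpow_add hx0]
          congr 2
          push_cast
          ring
      _ ≤ (s : ℝ) ^ ω := Real.rpow_le_rpow (by positivity) h6 (by linarith)
  have h8 : 0 ≤ e * q ^ (k + 1) := by positivity
  have h9 : 0 ≤ (s : ℝ) ^ ω / (x : ℝ) ^ (ω - 2) := by positivity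
  calc (x : ℝ) ^ 2 * ((12 + e) * D ^ (k + 1) - e * q ^ (k + 1))
      ≤ (x : ℝ) ^ 2 * ((12 + e) * D ^ (k + 1)) := by gcongr; linarith
    _ = (12 + e) * D * ((x : ℝ) ^ 2 * D ^ k) := by ring
    _ ≤ (12 + e) * D * ((s : ℝ) ^ ω / (x : ℝ) ^ (ω - 2)) := by gcongr
    _ ≤ _ := by nlinarith [sq_nonneg (s : ℝ), mul_nonneg (by positivity : 0 ≤ (12 + e) * D)
                  (sq_nonneg (s : ℝ))]

theorem sq_le_rpow {ω : ℝ} (hω : 2 < ω) {s : ℕ} (hs : 1 ≤ s) : (s : ℝ) ^ 2 ≤ (s : ℝ) ^ ω := by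
  rw [← Real.rpow_natCast]
  exact Real.rpow_le_rpow_of_exponent_le (by exact_mod_cast hs) (by exact_mod_cast hω.le)

/-- A multiplication of size `s` costs `O(s ^ ω)`. -/
theorem exists_mul_costs_rpow {ω : ℝ} (hω : 2 < ω) (mm : BilinearAlg)
    (hmm : (mm.rank : ℝ) ≤ (mm.dim : ℝ) ^ ω) :
    ∃ C : ℝ, 0 < C ∧ ∀ (Φ : CostModel) (S : DirectSolver)
      (s : ℕ) (A B : Operand) (T : Loc) (ws : ℕ), 1 ≤ s → A.rows ≤ s → A.cols ≤ s →
        B.rows ≤ s → B.cols ≤ s → Costs Φ S (mul mm s A B T ws) (C * (s : ℝ) ^ ω) := by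
  obtain ⟨C, hC, h⟩ := exists_mul_costs hω mm hmm
  refine ⟨2 * C, by positivity, fun Φ S s A B T ws h1 h2 h3 h4 h5 =>
    (h Φ S 1 le_rfl (smallMul_one Φ S mm) s A B T ws h1 h2 h3 h4 h5).mono ?_⟩
  have := sq_le_rpow hω h1
  rw [Nat.cast_one, Real.one_rpow, div_one]
  nlinarith

/-! ### Blocked products, triangular solves and pivoted LU -/

theorem Costs.applyLeft {Φ : CostModel} {S : DirectSolver} {mm : BilinearAlg} {s : ℕ} {β : ℝ}
    (h : ∀ (A B : Operand) (T : Loc) (ws : ℕ), A.rows ≤ s → A.cols ≤ s → B.rows ≤ s →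
      B.cols ≤ s → Costs Φ S (mul mm s A B T ws) β) (w : ℕ) (G X : Loc) (ws : ℕ) :
    Costs Φ S (applyLeft mm s w G X ws) (pieces w s * (β + 6 * (s : ℝ) ^ 2)) := by
  have := Costs.each (Φ := Φ) (S := S) (l := List.range (pieces w s))
    (body := fun c => do
      mul mm s ⟨s, s, G⟩ ⟨s, min s (w - c * s), X.shift 0 (c * s)⟩ (dense ws s) (ws + s * s)
      RecJacobi.copyBlock s (min s (w - c * s)) (X.shift 0 (c * s)) (dense ws s))
    (w := β + 6 * (s : ℝ) ^ 2) fun c _ =>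
      ((h _ _ _ _ le_rfl le_rfl le_rfl (min_le_left _ _)).bind fun _ =>
        Costs.copyBlock _ _ _ _).mono (by
          have : ((min s (w - c * s) : ℕ) : ℝ) ≤ s := by exact_mod_cast min_le_left _ _
          nlinarith [(Nat.cast_nonneg s : (0 : ℝ) ≤ s)])
  simpa [RecJacobi.applyLeft] using this

theorem Costs.mulSub {Φ : CostModel} {S : DirectSolver} {mm : BilinearAlg} {s : ℕ} {β : ℝ}
    (h : ∀ (A B : Operand) (T : Loc) (ws : ℕ), A.rows ≤ s → A.cols ≤ s → B.rows ≤ s →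
      B.cols ≤ s → Costs Φ S (mul mm s A B T ws) β) (m n : ℕ) {k : ℕ} (hk : k ≤ s) (C A B : Loc)
    (ws : ℕ) :
    Costs Φ S (mulSub mm s m k n C A B ws)
      (pieces m s * (pieces n s * (β + 6 * (s : ℝ) ^ 2))) := by
  refine Costs.entries fun a c _ _ => ((h _ _ _ _ (min_le_left _ _) hk hk (min_le_left _ _)).bind
    fun _ => Costs.entries fun i j _ _ => Costs.arith _ _ _ _).mono ?_
  have h1 : ((min s (m - a * s) : ℕ) : ℝ) ≤ s := by exact_mod_cast min_le_left _ _
  have h2 : ((min s (n - c * s) : ℕ) : ℝ) ≤ s := by exact_mod_cast min_le_left _ _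
  have : ((min s (m - a * s) : ℕ) : ℝ) * ((min s (n - c * s) : ℕ) * 6) ≤ s * (s * 6) := by gcongr
  linarith

/-- Each half is at most `2 h / 3` (attained at `h = 3`) and the halves add up to `h`. Taking out
one factor of each half leaves exponent `ω - 2 > 0`, hence a contraction that makes divide and
conquer a geometric series. -/
theorem rpow_halves_le {ω : ℝ} (hω : 2 < ω) {h : ℕ} (hh : 2 ≤ h) :
    ((h / 2 : ℕ) : ℝ) ^ (ω - 1) + ((h - h / 2 : ℕ) : ℝ) ^ (ω - 1)
      ≤ (2 / 3 : ℝ) ^ (ω - 2) * (h : ℝ) ^ (ω - 1) := by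
  have aux : ∀ a : ℕ, 1 ≤ a → 3 * a ≤ 2 * h →
      (a : ℝ) ^ (ω - 1) ≤ a * ((2 / 3 : ℝ) ^ (ω - 2) * (h : ℝ) ^ (ω - 2)) := by
    intro a ha hah
    have ha' : (0 : ℝ) < a := by exact_mod_cast ha
    have hah' : (3 : ℝ) * a ≤ 2 * h := by exact_mod_cast hah
    rw [← Real.mul_rpow (by norm_num) (by positivity), show ω - 1 = 1 + (ω - 2) by ring,
      Real.rpow_add ha', Real.rpow_one]
    gcongr
    linarith
  have h1 := aux (h / 2) (by omega) (by omega)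
  have h2 := aux (h - h / 2) (by omega) (by omega)
  have h3 : (h : ℝ) ^ (ω - 1) = h * (h : ℝ) ^ (ω - 2) := by
    rw [show ω - 1 = 1 + (ω - 2) by ring,
      Real.rpow_add (by exact_mod_cast (by omega : 0 < h)), Real.rpow_one]
  have h4 : (h : ℝ) = ((h / 2 : ℕ) : ℝ) + ((h - h / 2 : ℕ) : ℝ) := by
    rw [← Nat.cast_add]
    congr 1
    omega
  calc _ ≤ (((h / 2 : ℕ) : ℝ) + ((h - h / 2 : ℕ) : ℝ))
        * ((2 / 3 : ℝ) ^ (ω - 2) * (h : ℝ) ^ (ω - 2)) := by rw [add_mul]; exact add_le_add h1 h2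
    _ = _ := by rw [← h4, h3]; ring

theorem two_thirds_rpow_lt_one {ω : ℝ} (hω : 2 < ω) : (2 / 3 : ℝ) ^ (ω - 2) < 1 :=
  Real.rpow_lt_one (by norm_num) (by norm_num) (by linarith)

/-- The tall case, for the LU update: there is at most one column of pieces. The extra bound `m'`
lets the truncated row count `m - (off + w / 2)` be replaced by `m`. -/
theorem Costs.mulSub_rpow {Φ : CostModel} {S : DirectSolver} {mm : BilinearAlg} {ω K : ℝ}
    (hK : 0 ≤ K) (h : ∀ (s : ℕ) (A B : Operand) (T : Loc) (ws : ℕ), 1 ≤ s → A.rows ≤ s →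
      A.cols ≤ s → B.rows ≤ s → B.cols ≤ s → Costs Φ S (mul mm s A B T ws) (K * (s : ℝ) ^ ω))
    (hω : 2 < ω) {s k m m' n : ℕ} (hs : 1 ≤ s) (hk : k ≤ s) (hmm : m ≤ m') (hn : n ≤ s)
    (C A B : Loc) (ws : ℕ) :
    Costs Φ S (RecJacobi.mulSub mm s m k n C A B ws)
      ((K + 6) * ((m' + s) * (s : ℝ) ^ (ω - 1))) := by
  have hs' : (0 : ℝ) < s := by exact_mod_cast hs
  refine (Costs.mulSub (fun A B T ws => h s A B T ws hs) m n hk C A B ws).mono ?_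
  have h1 : (pieces n s : ℝ) ≤ 1 := by exact_mod_cast pieces_le hs (by simpa using hn)
  have h2 : (pieces m s : ℝ) ≤ m' / s + 1 := by
    refine (pieces_le_div_add_one m hs).trans ?_
    gcongr
  have h3 : (s : ℝ) ^ ω = s * (s : ℝ) ^ (ω - 1) := by
    rw [← Real.rpow_one_add' hs'.le (by linarith)]
    congr 1
    ring
  have h4 := sq_le_rpow hω hs
  calc (pieces m s : ℝ) * (pieces n s * (K * (s : ℝ) ^ ω + 6 * (s : ℝ) ^ 2))
      ≤ (m' / s + 1) * (1 * (K * (s : ℝ) ^ ω + 6 * (s : ℝ) ^ ω)) := by gcongr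
    _ = _ := by rw [h3]; field_simp

/-- The wide case, for triangular solves: there is at most one row of pieces. -/
theorem Costs.mulSub_rpow' {Φ : CostModel} {S : DirectSolver} {mm : BilinearAlg} {ω K : ℝ}
    (hK : 0 ≤ K) (h : ∀ (s : ℕ) (A B : Operand) (T : Loc) (ws : ℕ), 1 ≤ s → A.rows ≤ s →
      A.cols ≤ s → B.rows ≤ s → B.cols ≤ s → Costs Φ S (mul mm s A B T ws) (K * (s : ℝ) ^ ω))
    (hω : 2 < ω) {s k m n : ℕ} (hs : 1 ≤ s) (hk : k ≤ s) (hm : m ≤ s)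
    (C A B : Loc) (ws : ℕ) :
    Costs Φ S (RecJacobi.mulSub mm s m k n C A B ws)
      ((K + 6) * ((n + s) * (s : ℝ) ^ (ω - 1))) := by
  have hs' : (0 : ℝ) < s := by exact_mod_cast hs
  refine (Costs.mulSub (fun A B T ws => h s A B T ws hs) m n hk C A B ws).mono ?_
  have h1 : (pieces m s : ℝ) ≤ 1 := by exact_mod_cast pieces_le hs (by simpa using hm)
  have h2 := pieces_le_div_add_one n hs
  have h3 : (s : ℝ) ^ ω = s * (s : ℝ) ^ (ω - 1) := by
    rw [← Real.rpow_one_add' hs'.le (by linarith)]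
    congr 1
    ring
  have h4 := sq_le_rpow hω hs
  calc (pieces m s : ℝ) * (pieces n s * (K * (s : ℝ) ^ ω + 6 * (s : ℝ) ^ 2))
      ≤ 1 * ((n / s + 1) * (K * (s : ℝ) ^ ω + 6 * (s : ℝ) ^ ω)) := by gcongr
    _ = _ := by rw [h3]; field_simp

theorem exists_trisolve_costs {ω : ℝ} (hω : 2 < ω) (mm : BilinearAlg)
    (hmm : (mm.rank : ℝ) ≤ (mm.dim : ℝ) ^ ω) :
    ∃ C : ℝ, 0 < C ∧ ∀ (Φ : CostModel) (S : DirectSolver) (h w : ℕ) (L B : Loc) (ws : ℕ),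
      Costs Φ S (trisolve mm h w L B ws) (C * ((w + h) * (h : ℝ) ^ (ω - 1))) := by
  obtain ⟨K, hK, hmul⟩ := exists_mul_costs_rpow hω mm hmm
  have hρ := two_thirds_rpow_lt_one hω
  set ρ : ℝ := (2 / 3 : ℝ) ^ (ω - 2)
  -- Fixed point of `C = ρ C + (K + 6)`: the two halves contribute `ρ C`, the update `K + 6`.
  set C : ℝ := (K + 6) / (1 - ρ) with hC
  have hC0 : 0 < C := div_pos (by linarith) (by linarith)
  have hCρ : C * (1 - ρ) = K + 6 := div_mul_cancel₀ _ (by linarith)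
  refine ⟨C, hC0, fun Φ S h => ?_⟩
  induction h using Nat.strong_induction_on with
  | _ h ih =>
  intro w L B ws
  rw [trisolve]
  split_ifs with hh
  · exact Costs.pure _ (by positivity)
  refine ((ih (h / 2) (by omega) _ _ _ _).bind fun _ =>
    (Costs.mulSub_rpow' hK.le (hmul Φ S) hω (by omega) (by omega) le_rfl _ _ _ _).bind fun _ =>
      ih (h - h / 2) (by omega) _ _ _ _).mono ?_
  have h1 := rpow_halves_le hω (by omega : 2 ≤ h)
  have h2 : ((h / 2 : ℕ) : ℝ) ≤ h := by exact_mod_cast Nat.div_le_self _ _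
  have h3 : ((h - h / 2 : ℕ) : ℝ) ≤ h := by exact_mod_cast Nat.sub_le _ _
  have hp : 0 ≤ ω - 1 := by linarith
  calc _ ≤ C * ((w + h) * ((h / 2 : ℕ) : ℝ) ^ (ω - 1)) + ((K + 6) * ((w + h) * (h : ℝ) ^ (ω - 1))
        + C * ((w + h) * ((h - h / 2 : ℕ) : ℝ) ^ (ω - 1))) := by gcongr
    _ = (w + h) * (C * (((h / 2 : ℕ) : ℝ) ^ (ω - 1) + ((h - h / 2 : ℕ) : ℝ) ^ (ω - 1))
        + (K + 6) * (h : ℝ) ^ (ω - 1)) := by ring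
    _ ≤ (w + h) * (C * (ρ * (h : ℝ) ^ (ω - 1)) + (K + 6) * (h : ℝ) ^ (ω - 1)) := by gcongr
    _ = _ := by rw [← hCρ]; ring

/-- Every node of the recursion pays for a pivot search and row swaps across the full matrix, linear
in `m + n`. As `w ≥ 1`, this fits into the same term as the solve and the update, and the halving
contraction sums the levels. -/
theorem exists_lupp_costs {ω : ℝ} (hω : 2 < ω) (mm : BilinearAlg)
    (hmm : (mm.rank : ℝ) ≤ (mm.dim : ℝ) ^ ω) :
    ∃ C : ℝ, 0 < C ∧ ∀ (Φ : CostModel) (S : DirectSolver) (m n : ℕ) (Y P : Loc) (ws off w : ℕ),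
      1 ≤ w → Costs Φ S (lupp mm m n Y P ws off w) (C * ((m + n + w) * (w : ℝ) ^ (ω - 1))) := by
  obtain ⟨K, hK, hmul⟩ := exists_mul_costs_rpow hω mm hmm
  obtain ⟨T, hT, htri⟩ := exists_trisolve_costs hω mm hmm
  have hρ := two_thirds_rpow_lt_one hω
  have hρ0 : 0 < (2 / 3 : ℝ) ^ (ω - 2) := by positivity
  set ρ : ℝ := (2 / 3 : ℝ) ^ (ω - 2)
  -- Pivoting takes 60 and the divisions in a leaf 6, so a leaf needs `C ≥ 66`; an inner node needs
  -- `60 + T + (K + 6)` besides the halves.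
  set C : ℝ := (66 + T + (K + 6)) / (1 - ρ) with hC
  have hC0 : 0 < C := div_pos (by linarith) (by linarith)
  have hCρ : C * (1 - ρ) = 66 + T + (K + 6) := div_mul_cancel₀ _ (by linarith)
  refine ⟨C, hC0, fun Φ S m n Y P ws off w => ?_⟩
  have hp : 0 ≤ ω - 1 := by linarith
  induction w using Nat.strong_induction_on generalizing off with
  | _ w ih =>
  intro hw
  have hw' : (1 : ℝ) ≤ w := by exact_mod_cast hw
  have hw1 : 1 ≤ (w : ℝ) ^ (ω - 1) := Real.one_le_rpow hw' hp
  have hm0 : (0 : ℝ) ≤ m := Nat.cast_nonneg m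
  have hn0 : (0 : ℝ) ≤ n := Nat.cast_nonneg n
  have hpiv : (6 + 36 * m + 18 * n : ℝ) ≤ 60 * ((m + n + w) * (w : ℝ) ^ (ω - 1)) := by
    nlinarith
  rw [lupp]
  split_ifs with hh
  · refine ((Costs.pivotRow _ _ _).bind fun _ => Costs.each fun r _ =>
      Costs.arith _ _ _ _).mono ?_
    rw [List.length_range']
    have h1 : ((m - (off + 1) : ℕ) : ℝ) ≤ m := by exact_mod_cast Nat.sub_le _ _
    have h2 : 66 ≤ C := by nlinarith
    have h3 : 0 ≤ (m + n + w) * (w : ℝ) ^ (ω - 1) := by positivity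
    nlinarith
  refine ((Costs.pivotRow _ _ _).bind fun _ => (ih (w / 2) (by omega) _ (by omega)).bind fun _ =>
    (htri Φ S _ _ _ _ _).bind fun _ =>
    (Costs.mulSub_rpow hK.le (hmul Φ S) hω (by omega) (by omega) (Nat.sub_le _ _) le_rfl
      _ _ _ _).bind fun _ => ih (w - w / 2) (by omega) _ (by omega)).mono ?_
  have h1 := rpow_halves_le hω (by omega : 2 ≤ w)
  have h2 : ((w / 2 : ℕ) : ℝ) ≤ w := by exact_mod_cast Nat.div_le_self _ _
  have h3 : ((w - w / 2 : ℕ) : ℝ) ≤ w := by exact_mod_cast Nat.sub_le _ _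
  have h4 : ((w - w / 2 : ℕ) : ℝ) + ((w / 2 : ℕ) : ℝ) ≤ m + n + w := by
    have : ((w - w / 2 : ℕ) : ℝ) + ((w / 2 : ℕ) : ℝ) = w := by
      rw [← Nat.cast_add]
      congr 1
      omega
    linarith
  have h5 : (m : ℝ) + ((w - w / 2 : ℕ) : ℝ) ≤ m + n + w := by linarith
  calc _ ≤ 60 * ((m + n + w) * (w : ℝ) ^ (ω - 1))
        + (C * ((m + n + w) * ((w / 2 : ℕ) : ℝ) ^ (ω - 1))
        + (T * ((m + n + w) * (w : ℝ) ^ (ω - 1))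
        + ((K + 6) * ((m + n + w) * (w : ℝ) ^ (ω - 1))
        + C * ((m + n + w) * ((w - w / 2 : ℕ) : ℝ) ^ (ω - 1))))) := by gcongr
    _ = (m + n + w) * (C * (((w / 2 : ℕ) : ℝ) ^ (ω - 1) + ((w - w / 2 : ℕ) : ℝ) ^ (ω - 1))
        + (60 + T + (K + 6)) * (w : ℝ) ^ (ω - 1)) := by ring
    _ ≤ (m + n + w) * (C * (ρ * (w : ℝ) ^ (ω - 1)) + C * (1 - ρ) * (w : ℝ) ^ (ω - 1)) := by
        rw [hCρ]
        gcongr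
        norm_num
    _ = _ := by ring

/-! ### Memory footprints -/

/-- Every instruction that the program can carry out uses words from `U` only. -/
def Within (S : DirectSolver) {α : Type} (p : Prog α) (U : Finset ℕ) : Prop :=
  ∀ m, ∀ u ∈ (p.run S m).trace, u ⊆ U

section Within

variable {S : DirectSolver} {α β : Type} {U : Finset ℕ}

theorem Within.pure (x : α) : Within S (pure x : Prog α) U := by
  intro m u hu
  cases hu

theorem Within.bind {p : Prog α} {g : α → Prog β} (hp : Within S p U)
    (hg : ∀ a, Within S (g a) U) : Within S (p >>= g) U := by
  intro m u hu
  change u ∈ ((p.bind g).run S m).trace at hu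
  rw [(Prog.run_bind S p g m).2, List.mem_append] at hu
  exact hu.elim (hp m u) (hg _ _ u)

theorem Within.emit {i : Instr} (h : i.touches ⊆ U) : Within S (emit i) U := by
  intro m u hu
  obtain rfl : u = i.touches := by simpa [RecJacobi.emit, Prog.run] using hu
  exact h

theorem Within.each {l : List β} {body : β → Prog Unit} (h : ∀ x ∈ l, Within S (body x) U) :
    Within S (each l body) U := by
  induction l with
  | nil => exact Within.pure _
  | cons x xs ih => exact (h x (by simp)).bind fun _ => ih fun y hy => h y (by simp [hy])

theorem Within.entries {r c : ℕ} {body : ℕ → ℕ → Prog Unit}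
    (h : ∀ i j, i < r → j < c → Within S (body i j) U) : Within S (entries r c body) U :=
  Within.each fun i hi => Within.each fun j hj => h i j (List.mem_range.1 hi) (List.mem_range.1 hj)

theorem Within.combine {d t : ℕ} (u : Fin d → Fin d → ℝ) {Y : Operand} {X : Loc} {tmp : ℕ}
    (hY : ∀ i j, i < Y.rows → j < Y.cols → Y.loc i j ∈ U) (hX : ∀ i j, i < t → j < t → X i j ∈ U)
    (htmp : tmp ∈ U) : Within S (combine t u Y X tmp) U := by
  refine Within.entries fun i j hi hj => (Within.emit ?_).bind fun _ =>
    Within.each fun p _ => Within.each fun q _ => ?_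
  · simpa [Instr.touches] using hX i j hi hj
  split_ifs with h
  · refine (Within.emit ?_).bind fun _ => Within.emit ?_
    · simpa [Instr.touches, Finset.insert_subset_iff] using ⟨htmp, hY _ _ h.1 h.2⟩
    · simpa [Instr.touches, Finset.insert_subset_iff] using ⟨hX i j hi hj, htmp⟩
  · exact Within.pure _

theorem Within.scatter {d s t : ℕ} (u : Fin d → Fin d → ℝ) {X T : Loc} {tmp : ℕ}
    (hX : ∀ i j, i < t → j < t → X i j ∈ U) (hT : ∀ i j, i < s → j < s → T i j ∈ U)
    (htmp : tmp ∈ U) : Within S (scatter s t u X T tmp) U := by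
  refine Within.entries fun i j hi hj => Within.each fun p _ => Within.each fun q _ => ?_
  split_ifs with h
  · refine (Within.emit ?_).bind fun _ => Within.emit ?_
    · simpa [Instr.touches, Finset.insert_subset_iff] using ⟨htmp, hX i j hi hj⟩
    · simpa [Instr.touches, Finset.insert_subset_iff] using ⟨hT _ _ h.1 h.2, htmp⟩
  · exact Within.pure _

/-- The extreme case is `s = 3`, `d = 2`. The ratio 2/3 is small enough for the workspaces of all
recursion levels to fit together in `3 s ^ 2` words. -/
theorem three_mul_pieces_le {s d : ℕ} (hd : 2 ≤ d) (hs : 2 ≤ s) : 3 * pieces s d ≤ 2 * s := by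
  suffices pieces s d < 2 * s / 3 + 1 by omega
  unfold pieces
  rw [Nat.div_lt_iff_lt_mul (by omega)]
  have h1 : (2 * s / 3) * 2 ≤ (2 * s / 3) * d := Nat.mul_le_mul_left _ hd
  obtain ⟨e, rfl⟩ : ∃ e, d = e + 2 := ⟨d - 2, by omega⟩
  have h2 : 2 * s / 3 * 2 + e ≤ 2 * s / 3 * (e + 2) := by
    have : 1 * e ≤ 2 * s / 3 * e := Nat.mul_le_mul_right _ (by omega)
    linarith
  rw [Nat.add_mul]
  omega

theorem dense_bounds {base t i j : ℕ} (hi : i < t) (hj : j < t) :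
    base ≤ dense base t i j ∧ dense base t i j < base + t * t := by
  have : (i + 1) * t ≤ t * t := Nat.mul_le_mul_right _ hi
  rw [Nat.add_mul] at this
  unfold dense
  omega

/-- Successive products at one level reuse the same workspace, so the footprint depends on the depth
of the recursion and not on `rank`. -/
theorem Within.mul {mm : BilinearAlg} (s : ℕ) (hs : 1 ≤ s) {A B : Operand} {T : Loc} {ws : ℕ}
    (hA : ∀ i j, i < A.rows → j < A.cols → A.loc i j ∈ U)
    (hB : ∀ i j, i < B.rows → j < B.cols → B.loc i j ∈ U)
    (hT : ∀ i j, i < s → j < s → T i j ∈ U)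
    (hws : ∀ a, ws ≤ a → a < ws + 3 * (s * s) → a ∈ U) :
    Within S (mul mm s A B T ws) U := by
  induction s using Nat.strong_induction_on generalizing A B T ws with
  | _ s ih =>
  rw [RecJacobi.mul]
  split_ifs with h1 h2
  · refine Within.emit ?_
    simpa [Instr.touches, Finset.insert_subset_iff] using
      ⟨hT 0 0 hs hs, hA 0 0 h2.1 h2.2.1, hB 0 0 h2.2.2.1 h2.2.2.2⟩
  · exact Within.emit (by simpa [Instr.touches] using hT 0 0 hs hs)
  have ht0 := one_le_pieces (by have := mm.two_le; omega : 1 ≤ mm.dim) hs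
  have ht1 := pieces_lt mm.two_le h1
  have ht := three_mul_pieces_le mm.two_le (by omega : 2 ≤ s)
  set t := pieces s mm.dim
  -- One scratch word, three `t × t` blocks, and `3 t ^ 2` words for the recursive call.
  have htt : 1 + 6 * (t * t) ≤ 3 * (s * s) := by nlinarith
  have hw : ∀ a, ws ≤ a → a < ws + (1 + 6 * (t * t)) → a ∈ U := fun a ha ha' =>
    hws a ha (by omega)
  have hX : ∀ base, ws ≤ base → base + t * t ≤ ws + (1 + 6 * (t * t)) →
      ∀ i j, i < t → j < t → dense base t i j ∈ U := fun base hb hb' i j hi hj => by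
    have := dense_bounds (base := base) hi hj
    exact hw _ (by omega) (by omega)
  have hX1 := hX (ws + 1) (by omega) (by omega)
  have hX2 := hX (ws + 1 + t * t) (by omega) (by omega)
  have hX3 := hX (ws + 1 + 2 * (t * t)) (by omega) (by omega)
  have htmp : ws ∈ U := hw _ le_rfl (by omega)
  refine (Within.entries fun i j hi hj => Within.emit ?_).bind fun _ => Within.each fun l _ =>
    (Within.combine _ hA hX1 htmp).bind fun _ => (Within.combine _ hB hX2 htmp).bind fun _ =>
    (ih t ht1 ht0 hX1 hX2 hX3 fun a ha ha' => hw a (by omega) (by omega)).bind fun _ =>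
    Within.scatter _ hX3 hT htmp
  simpa [Instr.touches] using hT i j hi hj

end Within

/-! ### The two cost models -/

/-- Traces can be concatenated because each schedule starts and ends with an empty fast memory. -/
theorem Moves.append {M : ℕ} {c : Finset ℕ} {t t' : List (Finset ℕ)} {w w' : ℕ}
    (h : Moves M c t w) (h' : Moves M ∅ t' w') : Moves M c (t ++ t') (w + w') := by
  induction h with
  | done => simpa using h'
  | use hu _ ih => exact .use hu ih
  | load a ha hc _ ih =>
    rw [Nat.add_right_comm]
    exact .load a ha hc ih
  | evict a ha _ ih =>
    rw [Nat.add_right_comm]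
    exact .evict a ha ih

/-- Load all of `U`, run the whole trace without traffic, evict all of `U`. -/
theorem Moves.of_subset {M : ℕ} {U : Finset ℕ} {t : List (Finset ℕ)} (ht : ∀ u ∈ t, u ⊆ U)
    (hU : U.card ≤ M) : Moves M ∅ t (2 * U.card) := by
  have evictAll : ∀ c : Finset ℕ, Moves M c [] c.card := by
    intro c
    induction c using Finset.induction_on with
    | empty => exact .done
    | insert a c ha ih =>
      rw [Finset.card_insert_of_notMem ha]
      exact .evict a (by simp) (by simpa [Finset.erase_insert ha] using ih)
  have useAll : Moves M U t U.card := by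
    induction t with
    | nil => exact evictAll U
    | cons u t ih => exact .use (ht u (by simp)) (ih fun v hv => ht v (by simp [hv]))
  -- Here `c` is already loaded and `d` is still to be loaded.
  have loadAll : ∀ d c : Finset ℕ, c ∪ d = U → Disjoint c d → Moves M c t (U.card + d.card) := by
    intro d
    induction d using Finset.induction_on with
    | empty =>
      rintro c hc -
      simpa [← hc] using (by simpa [← hc] using useAll : Moves M c t c.card)
    | insert a d ha ih =>
      intro c hc hcd
      rw [Finset.disjoint_insert_right] at hcd
      rw [Finset.card_insert_of_notMem ha, ← Nat.add_assoc]
      refine .load a hcd.1 ?_ (ih (insert a c) ?_ ?_)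
      · refine lt_of_lt_of_le (Finset.card_lt_card (Finset.ssubset_iff.2 ⟨a, hcd.1, ?_⟩)) hU
        rw [← hc]
        intro b hb
        simp only [Finset.mem_insert, Finset.mem_union] at hb ⊢
        tauto
      · rw [← hc, Finset.insert_union, Finset.union_insert]
      · rw [Finset.disjoint_insert_left]
        exact ⟨ha, hcd.2⟩
  rw [two_mul]
  exact loadAll U ∅ (Finset.empty_union _) (Finset.disjoint_empty_left _)

/-- The number of arithmetic operations. -/
def flopModel : CostModel where
  rel k _ w := (k : ℝ) ≤ w
  nil := by simp
  append h h' := by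
    push_cast
    exact add_le_add h h'
  mono := le_trans
  basic hk _ := (Nat.cast_le_one.2 hk).trans (by norm_num)

/-- The number of words moved, for a fast memory of `M` words. -/
def moveModel (M : ℕ) (hM : 3 ≤ M) : CostModel where
  rel _ t w := ∃ w' : ℕ, Moves M ∅ t w' ∧ (w' : ℝ) ≤ w
  nil := ⟨0, .done, by simp⟩
  append := by
    rintro _ _ _ _ w w' ⟨v, hv, hvw⟩ ⟨v', hv', hvw'⟩
    exact ⟨v + v', hv.append hv', by push_cast; linarith⟩
  mono := by
    rintro _ _ _ _ ⟨v, hv, hvw⟩ h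
    exact ⟨v, hv, hvw.trans h⟩
  basic := by
    intro _ u _ hu
    refine ⟨_, Moves.of_subset (U := u) (by simp) (hu.trans hM), ?_⟩
    exact_mod_cast (by omega : 2 * u.card ≤ 6)

theorem Costs.of_within {M : ℕ} {hM : 3 ≤ M} {S : DirectSolver} {α : Type} {p : Prog α}
    {U : Finset ℕ} (h : Within S p U) (hU : U.card ≤ M) :
    Costs (moveModel M hM) S p (2 * U.card) :=
  fun m => ⟨_, Moves.of_subset (h m) hU, by push_cast; rfl⟩

theorem card_image_loc_le (r c : ℕ) (X : Loc) :
    ((Finset.range r ×ˢ Finset.range c).image fun p => X p.1 p.2).card ≤ r * c :=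
  Finset.card_image_le.trans (by simp)

/-- The footprint is at most `6 s ^ 2` words: two operands, the result and `3 s ^ 2` of workspace.
Loading and evicting it once gives the constant 12. -/
theorem smallMul_moveModel {M x : ℕ} (hM : 3 ≤ M) (hx : 6 * (x * x) ≤ M) (S : DirectSolver)
    (mm : BilinearAlg) : SmallMul (moveModel M hM) S mm x := by
  intro s A B T ws h1 hs hAr hAc hBr hBc
  set img : ℕ → ℕ → Loc → Finset ℕ := fun r c X =>
    (Finset.range r ×ˢ Finset.range c).image fun p => X p.1 p.2 with himg
  have mem_img : ∀ {r c : ℕ} {X : Loc} (i j : ℕ), i < r → j < c → X i j ∈ img r c X :=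
    fun i j hi hj => Finset.mem_image.2 ⟨(i, j), by simp [hi, hj], rfl⟩
  set U := img A.rows A.cols A.loc ∪ img B.rows B.cols B.loc ∪ img s s T ∪
    Finset.Ico ws (ws + 3 * (s * s)) with hU
  have hcard : U.card ≤ 6 * (s * s) := by
    have hA : (img A.rows A.cols A.loc).card ≤ s * s :=
      (card_image_loc_le _ _ _).trans (Nat.mul_le_mul hAr hAc)
    have hB : (img B.rows B.cols B.loc).card ≤ s * s :=
      (card_image_loc_le _ _ _).trans (Nat.mul_le_mul hBr hBc)
    have hT : (img s s T).card ≤ s * s := card_image_loc_le _ _ _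
    have h4 : (Finset.Ico ws (ws + 3 * (s * s))).card = 3 * (s * s) := by simp
    have := Finset.card_union_le (img A.rows A.cols A.loc ∪ img B.rows B.cols B.loc ∪ img s s T)
      (Finset.Ico ws (ws + 3 * (s * s)))
    have := Finset.card_union_le (img A.rows A.cols A.loc ∪ img B.rows B.cols B.loc) (img s s T)
    have := Finset.card_union_le (img A.rows A.cols A.loc) (img B.rows B.cols B.loc)
    rw [hU]
    omega
  have hW : Within S (mul mm s A B T ws) U := by
    refine Within.mul s h1 (fun i j hi hj => ?_) (fun i j hi hj => ?_) (fun i j hi hj => ?_)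
      fun a ha ha' => ?_
    · simp only [hU, Finset.mem_union]
      exact .inl (.inl (.inl (mem_img i j hi hj)))
    · simp only [hU, Finset.mem_union]
      exact .inl (.inl (.inr (mem_img i j hi hj)))
    · simp only [hU, Finset.mem_union]
      exact .inl (.inr (mem_img i j hi hj))
    · simp only [hU, Finset.mem_union, Finset.mem_Ico]
      exact .inr ⟨ha, ha'⟩
  have hss : s * s ≤ x * x := Nat.mul_le_mul hs hs
  refine (Costs.of_within hW (by omega)).mono ?_
  have : (U.card : ℝ) ≤ 6 * (s * s) := by exact_mod_cast hcard
  linarith [sq (s : ℝ)]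

theorem Costs.eigen_flopModel (S : DirectSolver) (k : ℕ) (A Q : Loc) :
    Costs flopModel S (RecJacobi.emit (.eigen k A Q)) (S.flops k) := by
  intro m
  simp [flopModel, RecJacobi.emit, Prog.run, Instr.flops]

theorem Costs.eigen_moveModel {M k : ℕ} (hM : 3 ≤ M) (hk : 2 * (k * k) ≤ M) (S : DirectSolver)
    (A Q : Loc) : Costs (moveModel M hM) S (RecJacobi.emit (.eigen k A Q)) (4 * (k : ℝ) ^ 2) := by
  have hcard : (Instr.eigen k A Q).touches.card ≤ 2 * (k * k) := by
    refine (Finset.card_union_le _ _).trans ?_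
    have := card_image_loc_le k k A
    have := card_image_loc_le k k Q
    omega
  refine (Costs.of_within (Within.emit subset_rfl) (hcard.trans hk)).mono ?_
  have : ((Instr.eigen k A Q).touches.card : ℝ) ≤ 2 * (k * k) := by exact_mod_cast hcard
  linarith [sq (k : ℝ)]

/-! ### Solution of the recursion -/

open Filter

theorem eventually_mul_rpow_le {p q : ℝ} (hpq : p < q) (c : ℝ) :
    ∀ᶠ n : ℕ in atTop, c * (n : ℝ) ^ p ≤ (n : ℝ) ^ q := by
  have h := ((tendsto_rpow_atTop (by linarith : 0 < q - p)).comp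
    tendsto_natCast_atTop_atTop).eventually_ge_atTop c
  filter_upwards [h, eventually_gt_atTop 0] with n hn hn0
  have hn0' : (0 : ℝ) < n := by exact_mod_cast hn0
  calc c * (n : ℝ) ^ p ≤ (n : ℝ) ^ (q - p) * (n : ℝ) ^ p := by gcongr; exact hn
    _ = _ := by rw [← Real.rpow_add hn0']; congr 1; ring

/-- Solution of the recursion `T n ≤ C (n ^ (2 (1 - f)) T (2 n ^ f) + n ^ γ / X + n ^ δ)`, where
`P n w` says that `T n ≤ w`. The leading constant does not depend on the initial values. -/
theorem eventually_of_recursion {f γ δ C X : ℝ} (hf0 : 0 < f) (hf1 : f < 1) (hγ : 2 < γ)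
    (hδ : δ < γ) (hC : 0 < C) (hX : 1 ≤ X) {P : ℕ → ℝ → Prop}
    (hmono : ∀ n w w', P n w → w ≤ w' → P n w') {n₁ : ℕ}
    (hsmall : ∀ n < n₁, ∃ K, P n K)
    (hstep : ∀ n, n₁ ≤ n → ∀ W, 0 ≤ W → (∀ s, s ≤ 2 * ⌊(n : ℝ) ^ f⌋₊ → s < n → P s W) →
      P n (C * ((n : ℝ) ^ (2 * (1 - f)) * W + (n : ℝ) ^ γ / X + (n : ℝ) ^ δ))) :
    ∀ᶠ n : ℕ in atTop, P n (3 * C * ((n : ℝ) ^ γ / X)) := by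
  have hfin : ∀ n, ∃ K, 0 ≤ K ∧ ∀ s < n, P s K := by
    intro n
    induction n with
    | zero => exact ⟨0, le_rfl, fun s hs => absurd hs (Nat.not_lt_zero _)⟩
    | succ n ih =>
      obtain ⟨K, hK, h⟩ := ih
      obtain ⟨K', h'⟩ : ∃ K', P n K' := by
        by_cases hn : n < n₁
        · exact hsmall n hn
        · exact ⟨_, hstep n (by omega) K hK fun s _ hs => h s hs⟩
      refine ⟨max K K', hK.trans (le_max_left _ _), fun s hs => ?_⟩
      rcases Nat.lt_succ_iff_lt_or_eq.1 hs with hs | rfl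
      · exact hmono _ _ _ (h s hs) (le_max_left _ _)
      · exact hmono _ _ _ h' (le_max_right _ _)
  -- The recursive term loses `(1 - f) (γ - 2) > 0` in the exponent.
  have hexp : ∀ n : ℕ, 1 ≤ n → (n : ℝ) ^ (2 * (1 - f)) * (2 * (n : ℝ) ^ f) ^ γ
      = 2 ^ γ * (n : ℝ) ^ (γ - (1 - f) * (γ - 2)) := by
    intro n hn
    have hn0 : (0 : ℝ) < n := by exact_mod_cast hn
    rw [Real.mul_rpow (by norm_num) (by positivity), ← Real.rpow_mul hn0.le, mul_left_comm,
      ← Real.rpow_add hn0]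
    congr 2
    ring
  have hlt : γ - (1 - f) * (γ - 2) < γ := by nlinarith
  have hev : ∀ c : ℝ, ∀ᶠ n : ℕ in atTop,
      c * ((n : ℝ) ^ (2 * (1 - f)) * (2 * (n : ℝ) ^ f) ^ γ) ≤ (n : ℝ) ^ γ := by
    intro c
    filter_upwards [eventually_mul_rpow_le hlt (c * 2 ^ γ), eventually_ge_atTop 1] with n hn hn1
    rw [hexp n hn1, ← mul_assoc]
    exact hn
  have hb : ∀ n s : ℕ, 1 ≤ n → s ≤ 2 * ⌊(n : ℝ) ^ f⌋₊ → max 1 (s : ℝ) ≤ 2 * (n : ℝ) ^ f := by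
    intro n s hn hs
    have h1 : 1 ≤ (n : ℝ) ^ f := Real.one_le_rpow (by exact_mod_cast hn) hf0.le
    have h2 : (⌊(n : ℝ) ^ f⌋₊ : ℝ) ≤ (n : ℝ) ^ f := Nat.floor_le (by positivity)
    have h3 : (s : ℝ) ≤ 2 * ⌊(n : ℝ) ^ f⌋₊ := by exact_mod_cast hs
    exact max_le (by linarith) (by linarith)
  obtain ⟨n₀, hn₀⟩ := eventually_atTop.1 ((hev (2 * C)).and
    ((eventually_mul_rpow_le hδ 1).and (eventually_ge_atTop (max 1 n₁))))
  obtain ⟨K₀, hK₀, hlow⟩ := hfin n₀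
  -- `K₀` covers the initial values. With `K ≥ 4 C`, the recursive term and the two forcing terms
  -- each take at most half of `K n ^ γ`.
  set K := max K₀ (4 * C) with hK
  have hK0 : 0 ≤ K := hK₀.trans (le_max_left _ _)
  have hweak : ∀ n, P n (K * (max 1 (n : ℝ)) ^ γ) := by
    intro n
    induction n using Nat.strong_induction_on with
    | _ n ih =>
    by_cases hn : n < n₀
    · refine hmono _ _ _ (hlow n hn) ((le_max_left _ _).trans (le_mul_of_one_le_right hK0 ?_))
      exact Real.one_le_rpow (le_max_left _ _) (by linarith)
    obtain ⟨h1, h2, h3⟩ := hn₀ n (not_lt.1 hn)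
    have hn1 : 1 ≤ n := (le_max_left _ _).trans h3
    have hn1' : (1 : ℝ) ≤ n := by exact_mod_cast hn1
    refine hmono _ _ _ (hstep n ((le_max_right _ _).trans h3) (K * (2 * (n : ℝ) ^ f) ^ γ)
      (by positivity) fun s hs hsn => hmono _ _ _ (ih s hsn) ?_) ?_
    · have := hb n s hn1 hs
      gcongr
    · rw [max_eq_right hn1']
      have h4 : (n : ℝ) ^ γ / X ≤ (n : ℝ) ^ γ := div_le_self (by positivity) hX
      have h5 : 4 * C ≤ K := le_max_right _ _
      have h6 : 0 ≤ (n : ℝ) ^ γ := by positivity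
      calc C * ((n : ℝ) ^ (2 * (1 - f)) * (K * (2 * (n : ℝ) ^ f) ^ γ) + (n : ℝ) ^ γ / X
            + (n : ℝ) ^ δ)
          = K / 2 * (2 * C * ((n : ℝ) ^ (2 * (1 - f)) * (2 * (n : ℝ) ^ f) ^ γ))
            + C * ((n : ℝ) ^ γ / X) + C * (1 * (n : ℝ) ^ δ) := by ring
        _ ≤ K / 2 * (n : ℝ) ^ γ + C * (n : ℝ) ^ γ + C * (n : ℝ) ^ γ := by gcongr
        _ ≤ K * (n : ℝ) ^ γ := by nlinarith
  have hX0 : 0 < X := by linarith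
  -- Second pass: the weak bound is inserted just once, and for large `n` the exponent gap absorbs
  -- both `K` and `X`. Three equal terms remain, whence the factor `3 C`.
  filter_upwards [hev (K * X), eventually_mul_rpow_le hδ X, eventually_ge_atTop (max 1 n₁)]
    with n h1 h2 h3
  have hn1 : 1 ≤ n := (le_max_left _ _).trans h3
  refine hmono _ _ _ (hstep n ((le_max_right _ _).trans h3) (K * (2 * (n : ℝ) ^ f) ^ γ)
    (by positivity) fun s hs hsn => hmono _ _ _ (hweak s) ?_) ?_
  · have := hb n s hn1 hs
    gcongr
  · have h4 : (n : ℝ) ^ (2 * (1 - f)) * (K * (2 * (n : ℝ) ^ f) ^ γ) ≤ (n : ℝ) ^ γ / X := by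
      rw [le_div_iff₀ hX0]
      linarith
    have h5 : (n : ℝ) ^ δ ≤ (n : ℝ) ^ γ / X := by
      rw [le_div_iff₀ hX0]
      linarith
    calc _ ≤ C * ((n : ℝ) ^ γ / X + (n : ℝ) ^ γ / X + (n : ℝ) ^ γ / X) := by gcongr
      _ = _ := by ring

/-! ### One sweep of recursive Jacobi -/

theorem length_blockPairs_le (N : ℕ) : (blockPairs N).length ≤ N * N := by
  unfold blockPairs
  rw [List.length_flatMap]
  refine (List.sum_le_card_nsmul _ N ?_).trans (by simp)
  intro x hx
  simp only [List.length_map, List.length_range, List.mem_map, List.mem_range] at hx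
  obtain ⟨a, ha, rfl⟩ := hx
  exact ha.le

/-- Only the cutoff 1 is used, so the bound holds in every model; no communication-efficient LU
analysis is needed. -/
theorem exists_pivotColumns_costs {ω : ℝ} (hω : 2 < ω) (mm : BilinearAlg)
    (hmm : (mm.rank : ℝ) ≤ (mm.dim : ℝ) ^ ω) :
    ∃ C : ℝ, 0 < C ∧ ∀ (Φ : CostModel) (S : DirectSolver) (b s : ℕ) (R : Loc) (ws : ℕ),
      1 ≤ b → b ≤ s → Costs Φ S (pivotColumns mm b s R ws) (C * (s : ℝ) ^ ω) := by
  obtain ⟨K, hK, hmul⟩ := exists_mul_costs_rpow hω mm hmm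
  obtain ⟨L, hL, hlu⟩ := exists_lupp_costs hω mm hmm
  refine ⟨18 + 3 * L + K, by positivity, fun Φ S b s R ws hb hbs => ?_⟩
  have hs : 1 ≤ s := hb.trans hbs
  refine ((Costs.setIdentity _ _).bind fun _ => (Costs.copyBlock _ _ _ _).bind fun _ =>
    (hlu Φ S _ _ _ _ _ _ _ hb).bind fun _ =>
    Costs.applyLeft (fun A B T ws => hmul Φ S s A B T ws hs) _ _ _ _).mono ?_
  have h1 : (pieces s s : ℝ) ≤ 1 := by exact_mod_cast pieces_le hs (by simp)
  have h2 : (b : ℝ) ≤ s := by exact_mod_cast hbs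
  have h3 := sq_le_rpow hω hs
  have h4 : (s : ℝ) ^ ω = s * (s : ℝ) ^ (ω - 1) := by
    rw [← Real.rpow_one_add' (by positivity) (by linarith)]
    congr 1
    ring
  have hp : 0 ≤ ω - 1 := by linarith
  calc _ ≤ s * (s * 6) + (s * (s * 6) + (L * ((s + s + s) * (s : ℝ) ^ (ω - 1))
        + 1 * (K * (s : ℝ) ^ ω + 6 * (s : ℝ) ^ 2))) := by gcongr
    _ = 18 * (s : ℝ) ^ 2 + 3 * L * (s * (s : ℝ) ^ (ω - 1)) + K * (s : ℝ) ^ ω := by ring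
    _ ≤ 18 * (s : ℝ) ^ ω + 3 * L * (s : ℝ) ^ ω + K * (s : ℝ) ^ ω := by rw [← h4]; gcongr
    _ = _ := by ring

theorem exists_rotate_costs {ω : ℝ} (hω : 2 < ω) (mm : BilinearAlg)
    (hmm : (mm.rank : ℝ) ≤ (mm.dim : ℝ) ^ ω) :
    ∃ C : ℝ, 0 < C ∧ ∀ (Φ : CostModel) (S : DirectSolver) (x : ℕ), 1 ≤ x → SmallMul Φ S mm x →
      ∀ (n s : ℕ) (idx : ℕ → ℕ) (A Q R : Loc) (ws : ℕ), 1 ≤ s →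
        Costs Φ S (rotate mm n s idx A Q R ws)
          (C * (pieces n s * ((s : ℝ) ^ ω / (x : ℝ) ^ (ω - 2) + (s : ℝ) ^ 2))) := by
  obtain ⟨K, hK, hmul⟩ := exists_mul_costs hω mm hmm
  refine ⟨3 * (K + 6), by positivity, fun Φ S x hx hsm n s idx A Q R ws hs => ?_⟩
  have h : ∀ G X : Loc, Costs Φ S (applyLeft mm s n G X ws) _ := fun G X =>
    Costs.applyLeft (fun A B T ws => hmul Φ S x hx hsm s A B T ws hs) _ _ _ _
  refine ((h _ _).bind fun _ => (h _ _).bind fun _ => h _ _).mono ?_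
  have h1 : 0 ≤ (s : ℝ) ^ ω / (x : ℝ) ^ (ω - 2) := by positivity
  calc _ = 3 * (pieces n s * (K * ((s : ℝ) ^ ω / (x : ℝ) ^ (ω - 2) + (s : ℝ) ^ 2)
        + 6 * (0 + (s : ℝ) ^ 2))) := by ring
    _ ≤ 3 * (pieces n s * (K * ((s : ℝ) ^ ω / (x : ℝ) ^ (ω - 2) + (s : ℝ) ^ 2)
        + 6 * ((s : ℝ) ^ ω / (x : ℝ) ^ (ω - 2) + (s : ℝ) ^ 2))) := by gcongr
    _ = _ := by ring

theorem exists_sweep_step {ω : ℝ} (hω : 2 < ω) (hω3 : ω ≤ 3) (mm : BilinearAlg)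
    (hmm : (mm.rank : ℝ) ≤ (mm.dim : ℝ) ^ ω) {f : ℝ} (hf0 : 0 < f) (hf1 : f < 1) :
    ∃ C : ℝ, 0 < C ∧ ∀ (Φ : CostModel) (S : DirectSolver) (x nthr : ℕ), 1 ≤ x →
      SmallMul Φ S mm x → ∀ n : ℕ, 1 ≤ n → ¬(n < nthr ∨ n ≤ 2 * ⌊(n : ℝ) ^ f⌋₊) → ∀ W : ℝ, 0 ≤ W →
      (∀ s, s ≤ 2 * ⌊(n : ℝ) ^ f⌋₊ → s < n → ∀ (o : Choices) (path : List (ℕ × ℕ)) (A Q : Loc)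
        (ws : ℕ), Costs Φ S (sweep mm f nthr o path s A Q ws) W) →
      ∀ (o : Choices) (path : List (ℕ × ℕ)) (A Q : Loc) (ws : ℕ),
        Costs Φ S (sweep mm f nthr o path n A Q ws)
          (C * ((n : ℝ) ^ 2 + ((n : ℝ) ^ (1 - f)) ^ 2 * (W + ((n : ℝ) ^ f) ^ ω
            + (n : ℝ) ^ (1 - f) * (((n : ℝ) ^ f) ^ ω / (x : ℝ) ^ (ω - 2) + ((n : ℝ) ^ f) ^ 2)))) := by
  obtain ⟨K, hK, hpiv⟩ := exists_pivotColumns_costs hω mm hmm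
  obtain ⟨L, hL, hrot⟩ := exists_rotate_costs hω mm hmm
  refine ⟨16 * (24 * 8 + 18 + 8 * K + 32 * L) + 42, by positivity, ?_⟩
  intro Φ S x nthr hx hsm n hn hnd W hW hrec o path A Q ws
  have hn1 : (1 : ℝ) ≤ n := by exact_mod_cast hn
  have hx1 : (0 : ℝ) < x := by exact_mod_cast hx
  set X : ℝ := (x : ℝ) ^ (ω - 2) with hX
  have hX0 : 0 < X := by positivity
  set β : ℝ := (n : ℝ) ^ f with hβ
  set ν : ℝ := (n : ℝ) ^ (1 - f) with hν
  have hβ1 : 1 ≤ β := Real.one_le_rpow hn1 hf0.le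
  have hν1 : 1 ≤ ν := Real.one_le_rpow hn1 (by linarith)
  have hβν : ν * β = n := by
    rw [hβ, hν, ← Real.rpow_add (by linarith)]
    norm_num
  have hb1 : 1 ≤ ⌊β⌋₊ := by rwa [Nat.one_le_floor_iff]
  have hbβ : (⌊β⌋₊ : ℝ) ≤ β := Nat.floor_le (by linarith)
  have hβb : β ≤ 2 * ⌊β⌋₊ := by
    have h1 := Nat.lt_floor_add_one β
    have h2 : (1 : ℝ) ≤ ⌊β⌋₊ := by exact_mod_cast hb1
    linarith
  -- Rounding down at most halves `β`, so `n / s ≤ 2 ν`; the incomplete last piece adds one.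
  have hpieces : ∀ s : ℕ, ⌊β⌋₊ ≤ s → (pieces n s : ℝ) ≤ 4 * ν := by
    intro s hs
    have hs' : (⌊β⌋₊ : ℝ) ≤ s := by exact_mod_cast hs
    have hs0 : 0 < (s : ℝ) := by exact_mod_cast hb1.trans hs
    refine (pieces_le_div_add_one n (hb1.trans hs)).trans ?_
    have : (n : ℝ) / s ≤ 2 * ν := by
      rw [div_le_iff₀ hs0, ← hβν]
      nlinarith
    linarith
  have hβω : (1 : ℝ) ≤ β ^ ω := Real.one_le_rpow hβ1 (by linarith)
  have body : ∀ IJ ∈ o.order path (pieces n ⌊β⌋₊),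
      Costs Φ S (do
        let s := ⌊β⌋₊ + min ⌊β⌋₊ (n - IJ.2 * ⌊β⌋₊)
        let idx := pairIndex ⌊β⌋₊ IJ.1 IJ.2
        let B := dense ws s
        let R := dense (ws + s * s) s
        copyBlock s s B (fun i j => A (idx i) (idx j))
        let far ← exceeds o.measure (o.tol (IJ :: path)) s B (ws + 2 * (s * s))
        if far then do
          let _ ← sweep mm f nthr o (IJ :: path) s B R (ws + 2 * (s * s))
          optionally (o.pivot (IJ :: path)) (pivotColumns mm ⌊β⌋₊ s R (ws + 2 * (s * s)))
          rotate mm n s idx A Q R (ws + 2 * (s * s)))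
        (W + (24 * 8 + 18 + 8 * K) * β ^ ω + 32 * L * (ν * (β ^ ω / X + β ^ 2))) := by
    intro IJ _
    have hsb : ⌊β⌋₊ + min ⌊β⌋₊ (n - IJ.2 * ⌊β⌋₊) ≤ 2 * ⌊β⌋₊ := by omega
    have hbs : ⌊β⌋₊ ≤ ⌊β⌋₊ + min ⌊β⌋₊ (n - IJ.2 * ⌊β⌋₊) := Nat.le_add_right _ _
    set s := ⌊β⌋₊ + min ⌊β⌋₊ (n - IJ.2 * ⌊β⌋₊) with hs
    have hs1 : 1 ≤ s := hb1.trans hbs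
    have hsβ : (s : ℝ) ≤ 2 * β := by
      have : (s : ℝ) ≤ 2 * ⌊β⌋₊ := by exact_mod_cast hsb
      linarith
    have hsω : (s : ℝ) ^ ω ≤ 8 * β ^ ω := by
      calc (s : ℝ) ^ ω ≤ (2 * β) ^ ω := by gcongr
        _ = 2 ^ ω * β ^ ω := Real.mul_rpow (by norm_num) (by linarith)
        -- This is where `ω ≤ 3` enters; it makes the constant numerical.
        _ ≤ 2 ^ (3 : ℝ) * β ^ ω := by gcongr; norm_num
        _ = _ := by norm_num
    have hs2 : (s : ℝ) ^ 2 ≤ 8 * β ^ ω := (sq_le_rpow hω hs1).trans hsω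
    have hs2' : (s : ℝ) ^ 2 ≤ 4 * β ^ 2 := by
      calc (s : ℝ) ^ 2 ≤ (2 * β) ^ 2 := by gcongr
        _ = _ := by ring
    refine ((Costs.copyBlock _ _ _ _).bind fun _ => (Costs.exceeds _ _ _ _ _).bind fun far => ?_ :
      Costs Φ S _ (s * (s * 6) + (18 + s * (s * 18) + (W + (K * (s : ℝ) ^ ω +
        L * (pieces n s * ((s : ℝ) ^ ω / X + (s : ℝ) ^ 2))))))).mono ?_
    · split_ifs
      · exact (hrec s hsb (by omega) _ _ _ _ _).bind fun _ =>
          (Costs.optionally (by positivity) (hpiv Φ S _ s _ _ hb1 hbs) _).bind fun _ =>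
            hrot Φ S x hx hsm n s _ _ _ _ _ hs1
      · exact Costs.pure _ (by positivity)
    · have h1 := hpieces s hbs
      have h2 : (s : ℝ) ^ ω / X + (s : ℝ) ^ 2 ≤ 8 * (β ^ ω / X + β ^ 2) := by
        have h3 : (s : ℝ) ^ ω / X ≤ 8 * β ^ ω / X := by gcongr
        have h4 : 8 * β ^ ω / X = 8 * (β ^ ω / X) := by ring
        nlinarith [sq_nonneg β]
      calc _ = W + 24 * (s : ℝ) ^ 2 + 18 + K * (s : ℝ) ^ ω
            + L * (pieces n s * ((s : ℝ) ^ ω / X + (s : ℝ) ^ 2)) := by ring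
        _ ≤ W + 24 * (8 * β ^ ω) + 18 * β ^ ω + K * (8 * β ^ ω)
            + L * (4 * ν * (8 * (β ^ ω / X + β ^ 2))) := by gcongr; linarith
        _ = _ := by ring
  set G : ℝ := 24 * 8 + 18 + 8 * K + 32 * L with hG
  set Y : ℝ := W + β ^ ω + ν * (β ^ ω / X + β ^ 2) with hY
  have hY0 : 0 ≤ Y := by positivity
  have hbody : W + (24 * 8 + 18 + 8 * K) * β ^ ω + 32 * L * (ν * (β ^ ω / X + β ^ 2)) ≤ G * Y := by
    have h1 : 0 ≤ ν * (β ^ ω / X + β ^ 2) := by positivity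
    have h2 : 0 ≤ β ^ ω := by linarith
    have h3 : 0 ≤ K := hK.le
    have h4 : 0 ≤ L := hL.le
    have e : G * Y - (W + (24 * 8 + 18 + 8 * K) * β ^ ω + 32 * L * (ν * (β ^ ω / X + β ^ 2)))
        = (G - 1) * W + 32 * L * β ^ ω + (24 * 8 + 18 + 8 * K) * (ν * (β ^ ω / X + β ^ 2)) := by
      rw [hG, hY]; ring
    have h5 : 0 ≤ (G - 1) * W := mul_nonneg (by rw [hG]; linarith) hW
    have h6 : 0 ≤ 32 * L * β ^ ω := by positivity
    have h7 : 0 ≤ (24 * 8 + 18 + 8 * K) * (ν * (β ^ ω / X + β ^ 2)) := by positivity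
    linarith
  have hlen : ((o.order path (pieces n ⌊β⌋₊)).length : ℝ) ≤ 16 * ν ^ 2 := by
    have h1 : (o.order path (pieces n ⌊β⌋₊)).length ≤ pieces n ⌊β⌋₊ * pieces n ⌊β⌋₊ := by
      rw [(o.order_perm _ _).length_eq]
      exact length_blockPairs_le _
    have h2 : ((o.order path (pieces n ⌊β⌋₊)).length : ℝ)
        ≤ pieces n ⌊β⌋₊ * pieces n ⌊β⌋₊ := by exact_mod_cast h1
    have h3 := hpieces _ le_rfl
    calc _ ≤ (pieces n ⌊β⌋₊ : ℝ) * pieces n ⌊β⌋₊ := h2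
      _ ≤ (4 * ν) * (4 * ν) := by gcongr
      _ = _ := by ring
  rw [sweep, dif_neg hnd]
  refine ((Costs.setIdentity _ _).bind fun _ => (Costs.each body).bind fun _ =>
    (Costs.exceeds _ _ _ _ _).bind fun _ => Costs.pure _ le_rfl).mono ?_
  have hG0 : 0 ≤ G := by positivity
  have hn2 : (1 : ℝ) ≤ (n : ℝ) ^ 2 := one_le_pow₀ hn1
  calc _ ≤ n * (n * 6) + (16 * ν ^ 2 * (G * Y) + (18 + n * (n * 18) + 0)) := by
        gcongr
    _ = 24 * (n : ℝ) ^ 2 + 18 + 16 * G * (ν ^ 2 * Y) := by ring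
    _ ≤ 42 * ((n : ℝ) ^ 2 + ν ^ 2 * Y) + 16 * G * ((n : ℝ) ^ 2 + ν ^ 2 * Y) := by
        have h1 : 0 ≤ ν ^ 2 * Y := by positivity
        have h2 : 0 ≤ G * (n : ℝ) ^ 2 := by positivity
        linarith
    _ = _ := by ring

/-- A sweep costs `O(n ^ (3 (1 - f) + ω f) / x ^ (ω - 2))` in every cost model in which
multiplications of size at most `x` are small. -/
theorem exists_eventually_sweep_costs {ω : ℝ} (hω : 2 < ω) (hω3 : ω ≤ 3) (mm : BilinearAlg)
    (hmm : (mm.rank : ℝ) ≤ (mm.dim : ℝ) ^ ω) {f : ℝ} (hf0 : 0 < f) (hf1 : f < 1) :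
    ∃ C : ℝ, 0 < C ∧ ∀ (Φ : CostModel) (S : DirectSolver) (x nthr : ℕ), 1 ≤ x →
      SmallMul Φ S mm x → (1 - f)⁻¹ < Real.logb 2 nthr →
      (∀ k < nthr, ∃ E, ∀ A Q, Costs Φ S (emit (.eigen k A Q)) E) →
      ∀ᶠ n : ℕ in atTop, ∀ (o : Choices) (path : List (ℕ × ℕ)) (A Q : Loc) (ws : ℕ),
        Costs Φ S (sweep mm f nthr o path n A Q ws)
          (C * ((n : ℝ) ^ (3 * (1 - f) + ω * f) / (x : ℝ) ^ (ω - 2))) := by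
  obtain ⟨C, hC, hstep⟩ := exists_sweep_step hω hω3 mm hmm hf0 hf1
  refine ⟨3 * (3 * C), by positivity, fun Φ S x nthr hx hsm hthr heig => ?_⟩
  have hx1 : (1 : ℝ) ≤ x := by exact_mod_cast hx
  have hinv : 0 < (1 - f)⁻¹ := inv_pos.2 (by linarith)
  have hnthr : 1 ≤ nthr := by
    rcases Nat.eq_zero_or_pos nthr with rfl | h
    · simp at hthr
      linarith
    · exact h
  -- The threshold hypothesis says `nthr ^ (1 - f) > 2`, hence `2 n ^ f < n`: the block-size test
  -- never triggers direct diagonalization above the threshold.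
  have hbig : ∀ n : ℕ, nthr ≤ n → ¬(n < nthr ∨ n ≤ 2 * ⌊(n : ℝ) ^ f⌋₊) := by
    intro n hn
    have hn1 : (1 : ℝ) ≤ n := by exact_mod_cast hnthr.trans hn
    have hn' : (nthr : ℝ) ≤ n := by exact_mod_cast hn
    have h0 : (0 : ℝ) < nthr := by exact_mod_cast hnthr
    have h1 : (2 : ℝ) ^ (1 - f)⁻¹ < nthr := (Real.lt_logb_iff_rpow_lt (by norm_num) h0).1 hthr
    have h2 : (2 : ℝ) < (n : ℝ) ^ (1 - f) := by
      calc (2 : ℝ) = ((2 : ℝ) ^ (1 - f)⁻¹) ^ (1 - f) := by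
            rw [← Real.rpow_mul (by norm_num), inv_mul_cancel₀ (by linarith), Real.rpow_one]
        _ < (nthr : ℝ) ^ (1 - f) := Real.rpow_lt_rpow (by positivity) h1 (by linarith)
        _ ≤ (n : ℝ) ^ (1 - f) := Real.rpow_le_rpow h0.le hn' (by linarith)
    have h3 : (0 : ℝ) < (n : ℝ) ^ f := by positivity
    have h4 : (⌊(n : ℝ) ^ f⌋₊ : ℝ) ≤ (n : ℝ) ^ f := Nat.floor_le h3.le
    have h5 : (n : ℝ) ^ (1 - f) * (n : ℝ) ^ f = n := by
      rw [← Real.rpow_add (by linarith)]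
      norm_num
    rintro (h | h)
    · omega
    · have h6 : (n : ℝ) ≤ 2 * ⌊(n : ℝ) ^ f⌋₊ := by exact_mod_cast h
      nlinarith
  set γ : ℝ := 3 * (1 - f) + ω * f with hγ
  -- The lower-order exponents: whole-matrix overhead, work done once per pair (mainly pivoting),
  -- and the quadratic part of the products. The last two lie below `γ` by `1 - f` and `(ω - 2) f`.
  set δ : ℝ := max 2 (max (2 * (1 - f) + ω * f) (3 * (1 - f) + 2 * f)) with hδ
  have hγ2 : 2 < γ := by nlinarith
  have hδγ : δ < γ := by
    refine max_lt hγ2 (max_lt ?_ ?_)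
    · rw [hγ]; linarith
    · rw [hγ]; nlinarith
  refine eventually_of_recursion (P := fun n w => ∀ (o : Choices) (path : List (ℕ × ℕ))
    (A Q : Loc) (ws : ℕ), Costs Φ S (sweep mm f nthr o path n A Q ws) w) hf0 hf1 hγ2 hδγ
    (by positivity) (Real.one_le_rpow hx1 (by linarith))
    (fun n w w' h hw o path A Q ws => (h o path A Q ws).mono hw) (n₁ := nthr) ?_ ?_
  · intro k hk
    obtain ⟨E, hE⟩ := heig k hk
    refine ⟨k * (k * 6) + (E + 0), fun o path A Q ws => ?_⟩
    rw [sweep, dif_pos (.inl hk)]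
    exact (Costs.setIdentity _ _).bind fun _ => (hE _ _).bind fun _ => Costs.pure _ le_rfl
  · intro n hn W hW hrec o path A Q ws
    have hn1 : 1 ≤ n := hnthr.trans hn
    have hn1' : (1 : ℝ) ≤ n := by exact_mod_cast hn1
    have hn0 : (0 : ℝ) < n := by linarith
    refine (hstep Φ S x nthr hx hsm n hn1 (hbig n hn) W hW hrec o path A Q ws).mono ?_
    have e1 : ((n : ℝ) ^ (1 - f)) ^ 2 = (n : ℝ) ^ (2 * (1 - f)) := by
      rw [← Real.rpow_natCast, ← Real.rpow_mul hn0.le]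
      congr 1
      push_cast
      ring
    have e2 : ((n : ℝ) ^ f) ^ ω = (n : ℝ) ^ (ω * f) := by
      rw [← Real.rpow_mul hn0.le, mul_comm]
    have e3 : ((n : ℝ) ^ f) ^ 2 = (n : ℝ) ^ (2 * f) := by
      rw [← Real.rpow_natCast, ← Real.rpow_mul hn0.le]
      congr 1
      push_cast
      ring
    have e4 : (n : ℝ) ^ (2 * (1 - f)) * (n : ℝ) ^ (1 - f) = (n : ℝ) ^ (3 * (1 - f)) := by
      rw [← Real.rpow_add hn0]
      congr 1
      ring
    have l1 : (n : ℝ) ^ 2 ≤ (n : ℝ) ^ δ := by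
      rw [← Real.rpow_natCast]
      exact Real.rpow_le_rpow_of_exponent_le hn1' (by push_cast; exact le_max_left _ _)
    have l2 : (n : ℝ) ^ (2 * (1 - f)) * (n : ℝ) ^ (ω * f) ≤ (n : ℝ) ^ δ := by
      rw [← Real.rpow_add hn0]
      exact Real.rpow_le_rpow_of_exponent_le hn1' ((le_max_left _ _).trans (le_max_right _ _))
    have l3 : (n : ℝ) ^ (3 * (1 - f)) * (n : ℝ) ^ (2 * f) ≤ (n : ℝ) ^ δ := by
      rw [← Real.rpow_add hn0]
      exact Real.rpow_le_rpow_of_exponent_le hn1' ((le_max_right _ _).trans (le_max_right _ _))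
    have e5 : (n : ℝ) ^ γ = (n : ℝ) ^ (3 * (1 - f)) * (n : ℝ) ^ (ω * f) := by
      rw [← Real.rpow_add hn0]
    rw [e1, e2, e3]
    have h1 : 0 ≤ (n : ℝ) ^ (2 * (1 - f)) * W := by positivity
    have h2 : 0 ≤ (n : ℝ) ^ γ / (x : ℝ) ^ (ω - 2) := by positivity
    calc _ = C * ((n : ℝ) ^ (2 * (1 - f)) * W + (n : ℝ) ^ γ / (x : ℝ) ^ (ω - 2) + ((n : ℝ) ^ 2
          + (n : ℝ) ^ (2 * (1 - f)) * (n : ℝ) ^ (ω * f)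
          + (n : ℝ) ^ (3 * (1 - f)) * (n : ℝ) ^ (2 * f))) := by rw [e5, ← e4]; ring
      _ ≤ C * (3 * ((n : ℝ) ^ (2 * (1 - f)) * W) + 3 * ((n : ℝ) ^ γ / (x : ℝ) ^ (ω - 2))
          + ((n : ℝ) ^ δ + (n : ℝ) ^ δ + (n : ℝ) ^ δ)) :=
          mul_le_mul_of_nonneg_left (by linarith) hC.le
      _ = _ := by ring

end RecJacobi

/-! ### The two bounds -/

theorem mainTheorem1 (ω : ℝ) (hω2 : 2 < ω) (hω3 : ω ≤ 3)
    (mm : RecJacobi.BilinearAlg) (hmm : (mm.rank : ℝ) ≤ (mm.dim : ℝ) ^ ω)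
    (f : ℝ) (hf0 : 0 < f) (hf1 : f < 1) :
    ∃ C : ℝ, 0 < C ∧ ∀ nthr M : ℕ, (1 - f)⁻¹ < Real.logb 2 nthr → (nthr : ℝ) ≤ √((M : ℝ) / 2) →
      ∀ S : RecJacobi.DirectSolver, ∀ᶠ n : ℕ in Filter.atTop,
        ∀ (o : RecJacobi.Choices) (A : Matrix (Fin n) (Fin n) ℝ), A.IsSymm →
          ((RecJacobi.sweepRun mm f nthr S o A).flops : ℝ) ≤ C * (n : ℝ) ^ (3 * (1 - f) + ω * f) ∧
          ∃ w : ℕ, RecJacobi.Moves M ∅ (RecJacobi.sweepRun mm f nthr S o A).trace w ∧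
            (w : ℝ) ≤ C * ((n : ℝ) ^ (3 * (1 - f) + ω * f) / (M : ℝ) ^ (ω / 2 - 1)) := by
  obtain ⟨C, hC, h⟩ := RecJacobi.exists_eventually_sweep_costs hω2 hω3 mm hmm hf0 hf1
  have h24 : (1 : ℝ) ≤ 24 ^ (ω / 2 - 1) := Real.one_le_rpow (by norm_num) (by linarith)
  refine ⟨C * 24 ^ (ω / 2 - 1), by positivity, fun nthr M hthr hM S => ?_⟩
  have hnthr : 2 < nthr := by
    have h1 : 1 ≤ (1 - f)⁻¹ := one_le_inv_iff₀.2 ⟨by linarith, by linarith⟩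
    rcases Nat.eq_zero_or_pos nthr with rfl | h0
    · simp at hthr
      linarith
    have h2 := (Real.lt_logb_iff_rpow_lt one_lt_two (by exact_mod_cast h0)).1 (h1.trans_lt hthr)
    rw [Real.rpow_one] at h2
    exact_mod_cast h2
  have hMn : 2 * (nthr * nthr) ≤ M := by
    rw [Real.le_sqrt' (by exact_mod_cast (by omega : 0 < nthr))] at hM
    have : (2 : ℝ) * (nthr * nthr) ≤ M := by nlinarith
    exact_mod_cast this
  have hM18 : 18 ≤ M := by nlinarith
  -- Up to rounding, the largest cutoff with `6 x ^ 2 ≤ M`. Conversely `M < 6 (x + 1) ^ 2 ≤ 24 x ^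
  -- 2`, so replacing `x ^ (ω - 2)` by `M ^ (ω / 2 - 1)` costs the factor `24 ^ (ω / 2 - 1)`.
  set x := Nat.sqrt (M / 6) with hx
  have hx1 : 1 ≤ x := Nat.le_sqrt.2 (by omega)
  have hxM : 6 * (x * x) ≤ M := by
    have : x * x ≤ M / 6 := Nat.sqrt_le (M / 6)
    omega
  have hMx : M ≤ 24 * x ^ 2 := by
    have h1 : M / 6 < (x + 1) * (x + 1) := Nat.lt_succ_sqrt (M / 6)
    have h2 : (x + 1) * (x + 1) ≤ 4 * x ^ 2 := by nlinarith
    omega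
  have hM0 : (0 : ℝ) < M := by exact_mod_cast (by omega : 0 < M)
  have hx0 : (0 : ℝ) < x := by exact_mod_cast hx1
  have hMx' : (M : ℝ) ^ (ω / 2 - 1) ≤ 24 ^ (ω / 2 - 1) * (x : ℝ) ^ (ω - 2) := by
    have h1 : (M : ℝ) ≤ 24 * (x : ℝ) ^ 2 := by exact_mod_cast hMx
    calc (M : ℝ) ^ (ω / 2 - 1) ≤ (24 * (x : ℝ) ^ 2) ^ (ω / 2 - 1) :=
          Real.rpow_le_rpow hM0.le h1 (by linarith)
      _ = _ := by
          rw [Real.mul_rpow (by norm_num) (by positivity), ← Real.rpow_natCast (x : ℝ) 2,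
            ← Real.rpow_mul hx0.le]
          congr 2
          push_cast
          ring
  -- The same theorem twice: flops with cutoff 1, moves with cutoff `x`. In the second, `k < nthr`
  -- and `2 nthr ^ 2 ≤ M` let both operands of a direct diagonalization fit.
  filter_upwards [h RecJacobi.flopModel S 1 nthr le_rfl (RecJacobi.smallMul_one _ _ _) hthr
      fun k _ => ⟨S.flops k, RecJacobi.Costs.eigen_flopModel S k⟩,
    h (RecJacobi.moveModel M (by omega)) S x nthr hx1 (RecJacobi.smallMul_moveModel _ hxM _ _) hthr
      fun k hk => ⟨4 * (k : ℝ) ^ 2, RecJacobi.Costs.eigen_moveModel _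
        (by nlinarith) S⟩] with n hflops hmoves o A _
  refine ⟨?_, ?_⟩
  · have h1 := hflops o [] (RecJacobi.dense 0 n) (RecJacobi.dense (n * n) n) (2 * (n * n))
      (RecJacobi.inputMem A)
    rw [Nat.cast_one, Real.one_rpow, div_one] at h1
    exact le_trans h1 (mul_le_mul_of_nonneg_right (le_mul_of_one_le_right hC.le h24)
      (by positivity))
  · obtain ⟨w, hw, hle⟩ := hmoves o [] (RecJacobi.dense 0 n) (RecJacobi.dense (n * n) n)
      (2 * (n * n)) (RecJacobi.inputMem A)
    refine ⟨w, hw, hle.trans ?_⟩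
    rw [mul_assoc]
    refine mul_le_mul_of_nonneg_left ?_ hC.le
    rw [← mul_div_assoc, div_le_div_iff₀ (by positivity) (by positivity)]
    calc _ ≤ (n : ℝ) ^ (3 * (1 - f) + ω * f) * (24 ^ (ω / 2 - 1) * (x : ℝ) ^ (ω - 2)) := by gcongr
      _ = _ := by ring
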